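/- Let $V=\mathbb C(z)$ or $V=\mathbb C((z))$, with $\partial=d/dz$, $f'=\partial f$, and let $\operatorname{Diff}(V)$ be the Lie algebra (under the commutator) of differential operators $\sum_{j=0}^k\xi_j\partial^j$, $\xi_j\in V$; such an operator has order $k$ if $\xi_k\neq0$. Let $\mathrm{Witt}$ be the complex Lie algebra with basis $L_i$ ($i\in\mathbb Z$) and $[L_i,L_j]=(i-j)L_{i+j}$; let $\mathrm{Witt}_>$, $\mathrm{Witt}_<$ and $\mathfrak{sl}(2)$ be the Lie subalgebras spanned by the $L_i$ with $i\ge-1$, with $i\le1$, and with $-1\le i\le1$; and let $\mathrm{Vir}=\mathrm{Witt}\oplus\mathbb CK$ be the central extension given by the cocycle $\Psi(L_i,L_j)=\frac1{12}(i^3-i)\delta_{i+j,0}$. Let $\Theta(L_i)=(-1)^{i+1}L_{-i}$ be the Chevalley involution. Let $\mathcal S$ be the set of Lie algebra homomorphisms $\rho:\mathfrak{sl}(2)\to\operatorname{Diff}(V)$ with $\rho(L_0)$ of order $1$, and $\mathcal S_k\subset\mathcal S$ the subset where $\rho(L_{-1})$ has order $k$. For $\mathfrak g$ one of $\mathrm{Witt}_>,\mathrm{Witt}_<,\mathrm{Witt},\mathrm{Vir}$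 define $\mathcal R(\mathfrak g)$ and $\mathcal R_k(\mathfrak g)$ in the same way, and let $r:\mathcal R(\mathfrak g)\to\mathcal S$ be restriction to $\mathfrak{sl}(2)$. Put $\mathbb C_{\mathrm{sl}}=\{c:\operatorname{Re}c>-\frac12\}\cup\{c:\operatorname{Re}c=-\frac12,\ \operatorname{Im}c\ge0\}$, $\mathcal T_1=\{(h,b,c)\in V\times V\times\mathbb C: h'\ne0\}$ and $\mathcal T_0=\mathcal T_2=\{(h,b,c)\in\mathcal T_1:c\in\mathbb C_{\mathrm{sl}}\}$. For $k=0,1,2$ the following formulas define a bijection between $\mathcal T_k$ and $\mathcal S_k$ ("the triple associated to $\rho$"): for $k=1$, $\rho(L_i)=-\frac{h^{i+1}}{h'}\partial+(b+ic)h^i$ ($i=-1,0,1$); for $k=0$, $\rho(L_{-1})=h^{-1}$, $\rho(L_0)=-\frac h{h'}\partial+b$, $\rho(L_1)=h(\rho(L_0)^2-\rho(L_0)-c(c+1))$; for $k=2$, $\rho(L_{-1})=h^{-1}(\rho(L_0)^2+\rho(L_0)-c(c+1))$, $\rho(L_0)=-\frac h{h'}\partial+b$, $\rho(L_1)=h$.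 Then, for each of the four $\mathfrak g$: (a) $\mathcal R(\mathfrak g)=\mathcal R_0(\mathfrak g)\sqcup\mathcal R_1(\mathfrak g)\sqcup\mathcal R_2(\mathfrak g)$ (disjoint union). (b) $r$ maps $\mathcal R_k(\mathfrak g)$ into $\mathcal S_k$ for $k=0,1,2$; $r:\mathcal R_1(\mathfrak g)\to\mathcal S_1$ is a bijection, and the fibers of $\mathcal R_0(\mathfrak g)\to\mathcal S_0$ and $\mathcal R_2(\mathfrak g)\to\mathcal S_2$ have at most $2$ elements. More precisely: (1) If $\rho\in\mathcal R_1(\mathfrak g)$ and $(h,b,c)\in\mathcal T_1$ is the triple associated to $r(\rho)$, then $\rho(L_i)=-\frac{h^{i+1}}{h'}\partial+(b+ic)h^i$ for all $L_i\in\mathfrak g$, and $\rho(K)=0$ if $\mathfrak g=\mathrm{Vir}$. (2) If $\rho\in\mathcal R_0(\mathrm{Witt}_>)$ and $(h,b,c)\in\mathcal T_0$ is the triple associated to $r(\rho)$, then there is $\lambda\in\{c,-c-1\}$ such that $\rho(L_0)=-\frac h{h'}\partial+b$, $\rho(L_{-1})=h^{-1}$ and $\rho(L_i)=h^i(\rho(L_0)+i\lambda)P(\rho(L_0)-\lambda-i,i)$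 for $i\ge1$, where $P(f,n)=f(f+1)\cdots(f+n-1)$. The map $r:\mathcal R_0(\mathrm{Witt}_>)\to\mathcal S_0$ is surjective, and its fiber over the realization with triple $(h,b,c)$ has exactly $2$ elements, except for $c=-\frac12$ and $c=0$, where it has exactly $1$. (3) If $\rho\in\mathcal R_2(\mathrm{Witt}_<)$ and $(h,b,c)\in\mathcal T_2$ is the triple associated to $r(\rho)$, then there is $\lambda\in\{c,-c-1\}$ such that $\rho(L_0)=-\frac h{h'}\partial+b$, $\rho(L_1)=h$ and $\rho(L_i)=h^i(\rho(L_0)+i\lambda)P(\rho(L_0)+\lambda+1,-i)$ for $i\le-1$. The map $r:\mathcal R_2(\mathrm{Witt}_<)\to\mathcal S_2$ is surjective, and its fiber over the realization with triple $(h,b,c)$ has exactly $2$ elements, except for $c=-\frac12$ and $c=0$, where it has exactly $1$. The map $\rho\mapsto\rho\circ\Theta$ is a bijection $\mathcal R_0(\mathrm{Witt}_>)\to\mathcal R_2(\mathrm{Witt}_<)$ and a bijection $\mathcal R_0(\mathrm{Witt}_<)\to\mathcal R_2(\mathrm{Witt}_>)$. (4) $\mathcal R_0(\mathrm{Witt}_<)$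 and $\mathcal R_2(\mathrm{Witt}_>)$ are empty. (5) For $\mathfrak g=\mathrm{Witt},\mathrm{Vir}$, the sets $\mathcal R_0(\mathfrak g)$ and $\mathcal R_2(\mathfrak g)$ are empty. -/

import Mathlib

open scoped Polynomial

noncomputable section

/-! ### The differential fields `ℂ(z)` and `ℂ((z))` -/

/-- The derivative `d/dz` of a rational function `p / q`, by the quotient rule
`(p' q - p q') / q ^ 2` applied to the reduced fraction. -/
def ratDeriv (f : RatFunc ℂ) : RatFunc ℂ :=
  algebraMap ℂ[X] (RatFunc ℂ)
      (Polynomial.derivative f.num * f.denom - f.num * Polynomial.derivative f.denom) /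
    algebraMap ℂ[X] (RatFunc ℂ) (f.denom ^ 2)

/-- `(V, D)` is, up to an isomorphism of differential `ℂ`-algebras, the field `ℂ(z)` of rational
functions with `d/dz`. -/
def IsRationalFunctions {V : Type*} [Field V] [Algebra ℂ V] (D : Derivation ℂ V V) : Prop :=
  ∃ e : V ≃+* RatFunc ℂ, (∀ a : ℂ, e (algebraMap ℂ V a) = RatFunc.C a) ∧
    ∀ f : V, e (D f) = ratDeriv (e f)

/-- `(V, D)` is, up to an isomorphism of differential `ℂ`-algebras, the field `ℂ((z))` of formal
Laurent series with `d/dz`. -/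
def IsLaurentSeries {V : Type*} [Field V] [Algebra ℂ V] (D : Derivation ℂ V V) : Prop :=
  ∃ e : V ≃+* LaurentSeries ℂ, (∀ a : ℂ, e (algebraMap ℂ V a) = HahnSeries.C a) ∧
    ∀ f : V, e (D f) = LaurentSeries.derivative ℂ (e f)

/-! ### The Witt algebra and its subalgebras -/

/-- The underlying vector space of the Witt algebra: finitely supported families
`x = ∑ i, x i • L i`. -/
def Witt : Type := ℤ →₀ ℂ

namespace Witt

instance : AddCommGroup Witt := inferInstanceAs (AddCommGroup (ℤ →₀ ℂ))
instance : Module ℂ Witt := inferInstanceAs (Module ℂ (ℤ →₀ ℂ))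

/-- The basis vector `L i`. -/
def L (i : ℤ) : Witt := Finsupp.single i (1 : ℂ)

/-- The coefficient of `L i` in `x`. -/
def coeff (x : Witt) (i : ℤ) : ℂ := (show ℤ →₀ ℂ from x) i

/-- The linear map out of the Witt algebra with prescribed values on the `L i`. -/
def lift {M : Type*} [AddCommGroup M] [Module ℂ M] (v : ℤ → M) : Witt →ₗ[ℂ] M :=
  Finsupp.linearCombination ℂ v

theorem lift_L {M : Type*} [AddCommGroup M] [Module ℂ M] (v : ℤ → M) (i : ℤ) :
    lift v (L i) = v i :=
  (Finsupp.linearCombination_single ℂ (1 : ℂ) i).trans (one_smul ℂ (v i))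

theorem induction_L {P : Witt → Prop} (x : Witt) (zero : P 0)
    (add : ∀ y z, P y → P z → P (y + z)) (smul : ∀ (a : ℂ) y, P y → P (a • y))
    (basis : ∀ i, P (L i)) : P x := by
  refine Finsupp.induction_linear (motive := P) x zero add fun i a => ?_
  have h : (Finsupp.single i a : ℤ →₀ ℂ) = a • Finsupp.single i (1 : ℂ) := by simp
  rw [h]
  exact smul a (L i) (basis i)

/-- The bilinear map with `[L i, L j] = (i - j) L (i + j)`. -/
def bracketMap : Witt →ₗ[ℂ] Witt →ₗ[ℂ] Witt :=
  lift fun i => lift fun j => ((i : ℂ) - (j : ℂ)) • L (i + j)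

theorem bracketMap_L (i j : ℤ) :
    bracketMap (L i) (L j) = ((i : ℂ) - (j : ℂ)) • L (i + j) := by
  simp only [bracketMap, lift_L]

theorem bracketMap_swap (x y : Witt) : bracketMap x y = - bracketMap y x := by
  induction x using induction_L with
  | zero => simp only [map_zero, LinearMap.zero_apply, neg_zero]
  | add x x' hx hx' => simp only [map_add, LinearMap.add_apply, hx, hx', neg_add]
  | smul a x hx => simp only [map_smul, LinearMap.smul_apply, hx, smul_neg]
  | basis i =>
    induction y using induction_L with
    | zero => simp only [map_zero, LinearMap.zero_apply, neg_zero]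
    | add x x' hx hx' => simp only [map_add, LinearMap.add_apply, hx, hx', neg_add]
    | smul a x hx => simp only [map_smul, LinearMap.smul_apply, hx, smul_neg]
    | basis j => rw [bracketMap_L, bracketMap_L, add_comm j i, ← neg_smul, neg_sub]

theorem bracketMap_self (x : Witt) : bracketMap x x = 0 := by
  have h2 : (2 : ℂ) • bracketMap x x = 0 := by
    rw [two_smul]
    exact add_eq_zero_iff_eq_neg.mpr (bracketMap_swap x x)
  exact (smul_eq_zero.mp h2).resolve_left two_ne_zero

theorem bracketMap_jacobi (x y z : Witt) :
    bracketMap x (bracketMap y z) =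
      bracketMap (bracketMap x y) z + bracketMap y (bracketMap x z) := by
  induction x using induction_L with
  | zero => simp only [map_zero, LinearMap.zero_apply, add_zero]
  | add x x' hx hx' => simp only [map_add, LinearMap.add_apply, hx, hx']; abel
  | smul a x hx => simp only [map_smul, LinearMap.smul_apply, hx, smul_add]
  | basis i =>
    induction y using induction_L with
    | zero => simp only [map_zero, LinearMap.zero_apply, add_zero]
    | add x x' hx hx' => simp only [map_add, LinearMap.add_apply, hx, hx']; abel
    | smul a x hx => simp only [map_smul, LinearMap.smul_apply, hx, smul_add]
    | basis j =>
      induction z using induction_L with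
      | zero => simp only [map_zero, add_zero]
      | add x x' hx hx' => simp only [map_add, hx, hx']; abel
      | smul a x hx => simp only [map_smul, hx, smul_add]
      | basis k =>
        simp only [bracketMap_L, map_smul, LinearMap.smul_apply, smul_smul]
        rw [show i + (j + k) = i + j + k by ring, show j + (i + k) = i + j + k by ring,
          ← add_smul]
        congr 1
        push_cast
        ring

instance : Bracket Witt Witt := ⟨fun x y => bracketMap x y⟩

instance : LieRing Witt where
  add_lie x y z := by
    change bracketMap (x + y) z = bracketMap x z + bracketMap y z
    rw [map_add, LinearMap.add_apply]
  lie_add x y z := map_add (bracketMap x) y z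
  lie_self := bracketMap_self
  leibniz_lie := bracketMap_jacobi

instance : LieAlgebra ℂ Witt where
  lie_smul a x y := map_smul (bracketMap x) a y

theorem lie_L (i j : ℤ) : ⁅L i, L j⁆ = ((i : ℂ) - (j : ℂ)) • L (i + j) := bracketMap_L i j

/-- The span of the `L i` with `i ∈ s`. -/
def spanOn (s : Set ℤ) : Submodule ℂ Witt := Submodule.span ℂ (L '' s)

theorem L_mem_spanOn {s : Set ℤ} {i : ℤ} (hi : i ∈ s) : L i ∈ spanOn s :=
  Submodule.subset_span ⟨i, hi, rfl⟩

theorem lie_mem_spanOn {s : Set ℤ} (hs : ∀ i ∈ s, ∀ j ∈ s, i ≠ j → i + j ∈ s) {x y : Witt}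
    (hx : x ∈ spanOn s) (hy : y ∈ spanOn s) : ⁅x, y⁆ ∈ spanOn s := by
  induction hx using Submodule.span_induction with
  | zero => rw [zero_lie]; exact zero_mem _
  | add a b _ _ ha hb => rw [add_lie]; exact add_mem ha hb
  | smul c a _ ha => rw [smul_lie]; exact Submodule.smul_mem _ c ha
  | mem a ha =>
    obtain ⟨i, hi, rfl⟩ := ha
    induction hy using Submodule.span_induction with
    | zero => rw [lie_zero]; exact zero_mem _
    | add a b _ _ ha hb => rw [lie_add]; exact add_mem ha hb
    | smul c a _ ha => rw [lie_smul]; exact Submodule.smul_mem _ c ha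
    | mem b hb =>
      obtain ⟨j, hj, rfl⟩ := hb
      rw [lie_L]
      by_cases hij : i = j
      · rw [hij, sub_self, zero_smul]; exact zero_mem _
      · exact Submodule.smul_mem _ _ (L_mem_spanOn (hs i hi j hj hij))

/-- The Lie subalgebra spanned by the `L i` with `i ∈ s`. -/
def subalgebraOn (s : Set ℤ) (hs : ∀ i ∈ s, ∀ j ∈ s, i ≠ j → i + j ∈ s) :
    LieSubalgebra ℂ Witt :=
  { spanOn s with lie_mem' := fun hx hy => lie_mem_spanOn hs hx hy }

theorem subalgebraOn_mono {s t : Set ℤ} {hs : ∀ i ∈ s, ∀ j ∈ s, i ≠ j → i + j ∈ s}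
    {ht : ∀ i ∈ t, ∀ j ∈ t, i ≠ j → i + j ∈ t} (h : s ⊆ t) :
    subalgebraOn s hs ≤ subalgebraOn t ht :=
  fun _ hx => Submodule.span_mono (Set.image_mono h) hx

end Witt

/-- `Witt_>`, spanned by the `L i` with `i ≥ -1`. -/
def WittPos : LieSubalgebra ℂ Witt :=
  Witt.subalgebraOn {i | -1 ≤ i} fun i hi j hj hij => by
    simp only [Set.mem_ofPred_eq] at *; omega

/-- `Witt_<`, spanned by the `L i` with `i ≤ 1`. -/
def WittNeg : LieSubalgebra ℂ Witt :=
  Witt.subalgebraOn {i | i ≤ 1} fun i hi j hj hij => by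
    simp only [Set.mem_ofPred_eq] at *; omega

/-- `sl(2)`, realized as the span of `L (-1)`, `L 0`, `L 1`
(a Chevalley basis is `f = L (-1)`, `h = -2 L 0`, `e = -L 1`). -/
def Sl2 : LieSubalgebra ℂ Witt :=
  Witt.subalgebraOn {i | -1 ≤ i ∧ i ≤ 1} fun i hi j hj hij => by
    simp only [Set.mem_ofPred_eq] at *; omega

/-- The element `L i` of `sl(2)`, for `-1 ≤ i ≤ 1`. -/
def Sl2.L (i : ℤ) (hi : -1 ≤ i ∧ i ≤ 1) : Sl2 := ⟨Witt.L i, Witt.L_mem_spanOn hi⟩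

/-! ### The Virasoro algebra -/

/-- The underlying vector space `Witt ⊕ ℂ K` of the Virasoro algebra. -/
def Vir : Type := Witt × ℂ

namespace Vir

instance : AddCommGroup Vir := inferInstanceAs (AddCommGroup (Witt × ℂ))
instance : Module ℂ Vir := inferInstanceAs (Module ℂ (Witt × ℂ))

/-- The cocycle `Ψ (L i, L j) = (i ^ 3 - i) / 12` if `i + j = 0`, and `0` otherwise. -/
def cocycle : Witt →ₗ[ℂ] Witt →ₗ[ℂ] ℂ :=
  Witt.lift fun i => Witt.lift fun j => if i + j = 0 then ((i : ℂ) ^ 3 - (i : ℂ)) / 12 else 0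

theorem cocycle_L (i j : ℤ) : cocycle (Witt.L i) (Witt.L j) =
    if i + j = 0 then ((i : ℂ) ^ 3 - (i : ℂ)) / 12 else 0 := by
  simp only [cocycle, Witt.lift_L]

theorem cocycle_swap (x y : Witt) : cocycle x y = - cocycle y x := by
  induction x using Witt.induction_L with
  | zero => simp only [map_zero, LinearMap.zero_apply, neg_zero]
  | add x x' hx hx' => simp only [map_add, LinearMap.add_apply, hx, hx', neg_add]
  | smul a x hx => simp only [map_smul, LinearMap.smul_apply, hx, smul_neg]
  | basis i =>
    induction y using Witt.induction_L with
    | zero => simp only [map_zero, LinearMap.zero_apply, neg_zero]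
    | add x x' hx hx' => simp only [map_add, LinearMap.add_apply, hx, hx', neg_add]
    | smul a x hx => simp only [map_smul, LinearMap.smul_apply, hx, smul_neg]
    | basis j =>
      rw [cocycle_L, cocycle_L, add_comm j i]
      split_ifs with h
      · rw [show j = -i by omega]
        push_cast
        ring
      · rw [neg_zero]

theorem cocycle_self (x : Witt) : cocycle x x = 0 :=
  self_eq_neg.mp (cocycle_swap x x)

theorem cocycle_leibniz (x y z : Witt) :
    cocycle x ⁅y, z⁆ = cocycle ⁅x, y⁆ z + cocycle y ⁅x, z⁆ := by
  change cocycle x (Witt.bracketMap y z) =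
    cocycle (Witt.bracketMap x y) z + cocycle y (Witt.bracketMap x z)
  induction x using Witt.induction_L with
  | zero => simp only [map_zero, LinearMap.zero_apply, add_zero]
  | add x x' hx hx' => simp only [map_add, LinearMap.add_apply, hx, hx']; abel
  | smul a x hx => simp only [map_smul, LinearMap.smul_apply, hx, smul_add]
  | basis i =>
    induction y using Witt.induction_L with
    | zero => simp only [map_zero, LinearMap.zero_apply, add_zero]
    | add x x' hx hx' => simp only [map_add, LinearMap.add_apply, hx, hx']; abel
    | smul a x hx => simp only [map_smul, LinearMap.smul_apply, hx, smul_add]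
    | basis j =>
      induction z using Witt.induction_L with
      | zero => simp only [map_zero, add_zero]
      | add x x' hx hx' => simp only [map_add, hx, hx']; abel
      | smul a x hx => simp only [map_smul, hx, smul_add]
      | basis k =>
        simp only [Witt.bracketMap_L, map_smul, LinearMap.smul_apply, cocycle_L, smul_eq_mul]
        rw [show i + (j + k) = i + j + k by ring, show j + (i + k) = i + j + k by ring]
        split_ifs with h
        · rw [show k = -i - j by omega]
          push_cast
          ring
        · ring

instance : Bracket Vir Vir := ⟨fun x y => (⁅x.1, y.1⁆, cocycle x.1 y.1)⟩

instance : LieRing Vir where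
  add_lie x y z := Prod.ext (add_lie x.1 y.1 z.1) (by
    change cocycle (x.1 + y.1) z.1 = cocycle x.1 z.1 + cocycle y.1 z.1
    rw [map_add, LinearMap.add_apply])
  lie_add x y z := Prod.ext (lie_add x.1 y.1 z.1) (map_add (cocycle x.1) y.1 z.1)
  lie_self x := Prod.ext (lie_self x.1) (cocycle_self x.1)
  leibniz_lie x y z := Prod.ext (leibniz_lie x.1 y.1 z.1) (cocycle_leibniz x.1 y.1 z.1)

instance : LieAlgebra ℂ Vir where
  lie_smul a x y := Prod.ext (lie_smul a x.1 y.1) (map_smul (cocycle x.1) a y.1)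

/-- The element `L i` of the Virasoro algebra. -/
def L (i : ℤ) : Vir := (Witt.L i, 0)

/-- The central element of the Virasoro algebra. -/
def K : Vir := (0, 1)

theorem cocycle_sl2 (x y : Sl2) : cocycle x y = 0 := by
  obtain ⟨x, hx⟩ := x
  obtain ⟨y, hy⟩ := y
  change cocycle x y = 0
  replace hx : x ∈ Witt.spanOn _ := hx
  replace hy : y ∈ Witt.spanOn _ := hy
  induction hx using Submodule.span_induction with
  | zero => rw [map_zero, LinearMap.zero_apply]
  | add a b _ _ ha hb => rw [map_add, LinearMap.add_apply, ha, hb, add_zero]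
  | smul c a _ ha => rw [map_smul, LinearMap.smul_apply, ha, smul_zero]
  | mem a ha =>
    obtain ⟨i, hi, rfl⟩ := ha
    induction hy using Submodule.span_induction with
    | zero => rw [map_zero]
    | add a b _ _ ha hb => rw [map_add, ha, hb, add_zero]
    | smul c a _ ha => rw [map_smul, ha, smul_zero]
    | mem b hb =>
      obtain ⟨j, hj, rfl⟩ := hb
      rw [cocycle_L]
      obtain ⟨h1, h2⟩ := hi
      split_ifs
      · interval_cases i <;> norm_num
      · rfl

/-- The embedding of `sl(2)` in the Virasoro algebra. -/
def ofSl2 : Sl2 →ₗ⁅ℂ⁆ Vir where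
  toFun x := ((x : Witt), 0)
  map_add' _ _ := Prod.ext rfl (add_zero (0 : ℂ)).symm
  map_smul' a _ := Prod.ext rfl (smul_zero a).symm
  map_lie' {x y} := Prod.ext rfl (cocycle_sl2 x y).symm

end Vir

/-! ### The four Lie algebras at once -/

/-- Names for `Witt_>`, `Witt_<`, `Witt` and `Vir`. -/
inductive WittKind
  | pos
  | neg
  | full
  | vir

namespace WittKind

/-- The Lie algebra with the given name. -/
def Alg : WittKind → Type
  | pos => WittPos
  | neg => WittNeg
  | full => Witt
  | vir => Vir

instance : ∀ g : WittKind, LieRing g.Alg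
  | pos => inferInstanceAs (LieRing WittPos)
  | neg => inferInstanceAs (LieRing WittNeg)
  | full => inferInstanceAs (LieRing Witt)
  | vir => inferInstanceAs (LieRing Vir)

instance : ∀ g : WittKind, LieAlgebra ℂ g.Alg
  | pos => inferInstanceAs (LieAlgebra ℂ WittPos)
  | neg => inferInstanceAs (LieAlgebra ℂ WittNeg)
  | full => inferInstanceAs (LieAlgebra ℂ Witt)
  | vir => inferInstanceAs (LieAlgebra ℂ Vir)

/-- The set of `i` such that `L i` belongs to the Lie algebra. -/
def supp : WittKind → Set ℤ
  | pos => {i | -1 ≤ i}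
  | neg => {i | i ≤ 1}
  | full => Set.univ
  | vir => Set.univ

/-- The element `L i` of the Lie algebra. -/
def L : ∀ (g : WittKind) (i : ℤ), i ∈ g.supp → g.Alg
  | pos, i, hi => (⟨Witt.L i, Witt.L_mem_spanOn hi⟩ : WittPos)
  | neg, i, hi => (⟨Witt.L i, Witt.L_mem_spanOn hi⟩ : WittNeg)
  | full, i, _ => Witt.L i
  | vir, i, _ => Vir.L i

/-- The embedding of `sl(2)`. -/
def ofSl2 : ∀ g : WittKind, Sl2 →ₗ⁅ℂ⁆ g.Alg
  | pos => LieSubalgebra.inclusion (K := Sl2) (K' := WittPos)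
      (Witt.subalgebraOn_mono fun _ h => h.1)
  | neg => LieSubalgebra.inclusion (K := Sl2) (K' := WittNeg)
      (Witt.subalgebraOn_mono fun _ h => h.2)
  | full => Sl2.incl
  | vir => Vir.ofSl2

theorem mem_supp : ∀ (g : WittKind) {i : ℤ}, -1 ≤ i ∧ i ≤ 1 → i ∈ g.supp
  | pos, _, h => h.1
  | neg, _, h => h.2
  | full, _, _ => trivial
  | vir, _, _ => trivial

theorem ofSl2_L (g : WittKind) (i : ℤ) (hi : -1 ≤ i ∧ i ≤ 1) :
    g.ofSl2 (Sl2.L i hi) = g.L i (g.mem_supp hi) := by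
  cases g <;> rfl

end WittKind

/-! ### The Chevalley involution -/

namespace Witt

/-- The linear map `L i ↦ (-1) ^ (i + 1) L (-i)`. -/
def chevalleyMap : Witt →ₗ[ℂ] Witt := lift fun i => (-1 : ℂ) ^ (i + 1) • L (-i)

theorem chevalleyMap_L (i : ℤ) : chevalleyMap (L i) = (-1 : ℂ) ^ (i + 1) • L (-i) :=
  lift_L _ i

theorem chevalleyMap_lie (x y : Witt) :
    chevalleyMap ⁅x, y⁆ = ⁅chevalleyMap x, chevalleyMap y⁆ := by
  change chevalleyMap (bracketMap x y) = bracketMap (chevalleyMap x) (chevalleyMap y)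
  induction x using induction_L with
  | zero => simp only [map_zero, LinearMap.zero_apply]
  | add x x' hx hx' => simp only [map_add, LinearMap.add_apply, hx, hx']
  | smul a x hx => simp only [map_smul, LinearMap.smul_apply, hx]
  | basis i =>
    induction y using induction_L with
    | zero => simp only [map_zero]
    | add x x' hx hx' => simp only [map_add, hx, hx']
    | smul a x hx => simp only [map_smul, hx]
    | basis j =>
      simp only [bracketMap_L, map_smul, chevalleyMap_L, LinearMap.smul_apply, smul_smul]
      rw [show -i + -j = -(i + j) by ring]
      congr 1
      rw [zpow_add₀ (by norm_num), zpow_add₀ (by norm_num), zpow_add₀ (by norm_num),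
        zpow_add₀ (by norm_num)]
      push_cast
      ring

/-- The Chevalley involution `Θ (L i) = (-1) ^ (i + 1) L (-i)` of the Witt algebra. -/
def chevalley : Witt →ₗ⁅ℂ⁆ Witt :=
  { chevalleyMap with map_lie' := fun {x y} => chevalleyMap_lie x y }

theorem chevalley_mem {s t : Set ℤ} (h : ∀ i ∈ s, -i ∈ t) {x : Witt} (hx : x ∈ spanOn s) :
    chevalley x ∈ spanOn t := by
  change chevalleyMap x ∈ spanOn t
  induction hx using Submodule.span_induction with
  | zero => rw [map_zero]; exact zero_mem _
  | add a b _ _ ha hb => rw [map_add]; exact add_mem ha hb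
  | smul c a _ ha => rw [map_smul]; exact Submodule.smul_mem _ c ha
  | mem a ha =>
    obtain ⟨i, hi, rfl⟩ := ha
    rw [chevalleyMap_L]
    exact Submodule.smul_mem _ _ (L_mem_spanOn (h i hi))

end Witt

/-- The Chevalley involution `Θ : Witt_< → Witt_>`. -/
def chevalleyNegPos : WittKind.neg.Alg →ₗ⁅ℂ⁆ WittKind.pos.Alg :=
  (show WittNeg →ₗ⁅ℂ⁆ WittPos from
    { toFun := fun x => ⟨Witt.chevalley x, Witt.chevalley_mem
        (fun i (hi : i ≤ 1) => show -1 ≤ -i by omega) x.2⟩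
      map_add' := fun x y => Subtype.ext (map_add Witt.chevalley (x : Witt) y)
      map_smul' := fun a x => Subtype.ext (map_smul Witt.chevalley a (x : Witt))
      map_lie' := fun {x y} => Subtype.ext (LieHom.map_lie Witt.chevalley (x : Witt) y) })

/-- The Chevalley involution `Θ : Witt_> → Witt_<`. -/
def chevalleyPosNeg : WittKind.pos.Alg →ₗ⁅ℂ⁆ WittKind.neg.Alg :=
  (show WittPos →ₗ⁅ℂ⁆ WittNeg from
    { toFun := fun x => ⟨Witt.chevalley x, Witt.chevalley_mem
        (fun i (hi : -1 ≤ i) => show -i ≤ 1 by omega) x.2⟩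
      map_add' := fun x y => Subtype.ext (map_add Witt.chevalley (x : Witt) y)
      map_smul' := fun a x => Subtype.ext (map_smul Witt.chevalley a (x : Witt))
      map_lie' := fun {x y} => Subtype.ext (LieHom.map_lie Witt.chevalley (x : Witt) y) })

/-! ### Differential operators -/

section Operators

variable {V : Type*} [Field V] [Algebra ℂ V] (D : Derivation ℂ V V)

/-- The operator `∂` on `V`. -/
def der : Module.End ℂ V := (D : V →ₗ[ℂ] V)

theorem der_mul_smul (a : V) (P : Module.End ℂ V) :
    der D * (a • P) = (D a) • P + a • (der D * P) := by
  ext f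
  change D (a * P f) = D a * P f + a * D (P f)
  rw [Derivation.leibniz, smul_eq_mul, smul_eq_mul]
  ring

theorem pow_der_mul_mem (j : ℕ) {Q : Module.End ℂ V}
    (hQ : Q ∈ Submodule.span V (Set.range fun k : ℕ => der D ^ k)) :
    der D ^ j * Q ∈ Submodule.span V (Set.range fun k : ℕ => der D ^ k) := by
  have key : ∀ Q ∈ Submodule.span V (Set.range fun k : ℕ => der D ^ k),
      der D * Q ∈ Submodule.span V (Set.range fun k : ℕ => der D ^ k) := by
    intro Q hQ
    induction hQ using Submodule.span_induction with
    | zero => rw [mul_zero]; exact zero_mem _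
    | add a b _ _ ha hb => rw [mul_add]; exact add_mem ha hb
    | smul c a hac ha =>
      rw [der_mul_smul]
      exact add_mem (Submodule.smul_mem _ _ hac) (Submodule.smul_mem _ _ ha)
    | mem a ha =>
      obtain ⟨k, rfl⟩ := ha
      exact Submodule.subset_span ⟨k + 1, pow_succ' _ _⟩
  induction j with
  | zero => rw [pow_zero, one_mul]; exact hQ
  | succ j ih => rw [pow_succ', mul_assoc]; exact key _ ih

/-- `Diff(V)`: the algebra of the operators `∑ j, ξ j ∂ ^ j` on `V` (finite sums, `ξ j ∈ V`), that
is, the `V`-linear span of the powers of `∂`. It is a Lie algebra under the commutator. -/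
def Diff : Subalgebra ℂ (Module.End ℂ V) where
  carrier := (Submodule.span V (Set.range fun j : ℕ => der D ^ j) : Set (Module.End ℂ V))
  add_mem' := add_mem
  mul_mem' := by
    intro P Q hP hQ
    replace hP : P ∈ Submodule.span V (Set.range fun j : ℕ => der D ^ j) := hP
    change P * Q ∈ Submodule.span V (Set.range fun j : ℕ => der D ^ j)
    induction hP using Submodule.span_induction with
    | zero => rw [zero_mul]; exact zero_mem _
    | add a b _ _ ha hb => rw [add_mul]; exact add_mem ha hb
    | smul c a _ ha => rw [smul_mul_assoc]; exact Submodule.smul_mem _ _ ha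
    | mem a ha =>
      obtain ⟨j, rfl⟩ := ha
      exact pow_der_mul_mem D j hQ
  algebraMap_mem' a := by
    have h : algebraMap ℂ (Module.End ℂ V) a = (algebraMap ℂ V a) • der D ^ 0 := by
      ext f
      change a • f = algebraMap ℂ V a * f
      rw [Algebra.smul_def]
    rw [h]
    exact Submodule.smul_mem _ _ (Submodule.subset_span ⟨0, rfl⟩)

/-- The commutator bracket on `Diff(V)`. -/
instance : LieRing (Diff D) := LieRing.ofAssociativeRing

instance : LieAlgebra ℂ (Diff D) := LieAlgebra.ofAssociativeAlgebra

/-- The operator `P` has order `k`: `P = ξ 0 + ξ 1 ∂ + ⋯ + ξ k ∂ ^ k` with `ξ k ≠ 0`. -/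
def HasOrder (P : Module.End ℂ V) (k : ℕ) : Prop :=
  ∃ ξ : ℕ → V, ξ k ≠ 0 ∧ P = ∑ j ∈ Finset.range (k + 1), ξ j • der D ^ j

/-- The set `S` of realizations of `sl(2)` for which `L 0` has order one. -/
def SlRealizations : Set (Sl2 →ₗ⁅ℂ⁆ Diff D) :=
  {σ | HasOrder D (σ (Sl2.L 0 (by norm_num))) 1}

/-- The subset `S_k` of the realizations in `S` for which `L (-1)` has order `k`. -/
def SlRealizationsOf (k : ℕ) : Set (Sl2 →ₗ⁅ℂ⁆ Diff D) :=
  {σ ∈ SlRealizations D | HasOrder D (σ (Sl2.L (-1) (by norm_num))) k}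

/-- The set `R(g)` of realizations of `g` for which `L 0` has order one. -/
def Realizations (g : WittKind) : Set (g.Alg →ₗ⁅ℂ⁆ Diff D) :=
  {ρ | HasOrder D (ρ (g.L 0 (g.mem_supp (by norm_num)))) 1}

/-- The subset `R_k(g)` of the realizations in `R(g)` for which `L (-1)` has order `k`. -/
def RealizationsOf (g : WittKind) (k : ℕ) : Set (g.Alg →ₗ⁅ℂ⁆ Diff D) :=
  {ρ ∈ Realizations D g | HasOrder D (ρ (g.L (-1) (g.mem_supp (by norm_num)))) k}

/-- The restriction map from realizations of `g` to realizations of `sl(2)`. -/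
def restrictSl2 (g : WittKind) (ρ : g.Alg →ₗ⁅ℂ⁆ Diff D) : Sl2 →ₗ⁅ℂ⁆ Diff D :=
  ρ.comp g.ofSl2

/-! ### Triples -/

/-- The set of `c ∈ ℂ` with `Re c > -1/2`, or `Re c = -1/2` and `Im c ≥ 0`. -/
def CSl : Set ℂ := {c | -1 / 2 < c.re ∨ (c.re = -1 / 2 ∧ 0 ≤ c.im)}

/-- A triple `(h, b, c)` with `h, b ∈ V` and `c ∈ ℂ`. -/
structure Triple (V : Type*) where
  /-- The function `h`. -/
  h : V
  /-- The function `b`. -/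
  b : V
  /-- The constant `c`. -/
  c : ℂ

/-- The triples that parametrize `S_0` and `S_2`: `h' ≠ 0` and `c` is in `CSl`. -/
def TriplesZero : Set (Triple V) := {t | D t.h ≠ 0 ∧ t.c ∈ CSl}

/-- The triples that parametrize `S_1`: `h' ≠ 0`. -/
def TriplesOne : Set (Triple V) := {t | D t.h ≠ 0}

/-- The operator `-(h / h') ∂ + b`. -/
def opZero (t : Triple V) : Module.End ℂ V := (-(t.h / D t.h)) • der D + t.b • 1

/-- The operator `-(h ^ (i + 1) / h') ∂ + (b + i c) h ^ i`. -/
def opOne (t : Triple V) (i : ℤ) : Module.End ℂ V :=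
  (-(t.h ^ (i + 1) / D t.h)) • der D + ((t.b + (i : V) * algebraMap ℂ V t.c) * t.h ^ i) • 1

/-- The scalar operator `a`. -/
def scal (a : ℂ) : Module.End ℂ V := algebraMap ℂ (Module.End ℂ V) a

/-- The Pochhammer symbol `P(f, n) = f (f + 1) ⋯ (f + n - 1)` of an operator, for `n ≥ 0`. -/
def poch (f : Module.End ℂ V) (n : ℕ) : Module.End ℂ V :=
  Polynomial.aeval f (ascPochhammer ℂ n)

/-- `t` is the triple of the realization `σ` in `S_0`: `L (-1) = h⁻¹`, `L 0 = -(h / h') ∂ + b` and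
`L 1 = h (L 0 ^ 2 - L 0 - c (c + 1))`. -/
def IsTripleZero (σ : Sl2 →ₗ⁅ℂ⁆ Diff D) (t : Triple V) : Prop :=
  (σ (Sl2.L (-1) (by norm_num)) : Module.End ℂ V) = t.h⁻¹ • 1 ∧
  (σ (Sl2.L 0 (by norm_num)) : Module.End ℂ V) = opZero D t ∧
  (σ (Sl2.L 1 (by norm_num)) : Module.End ℂ V) =
    t.h • (opZero D t ^ 2 - opZero D t - scal (t.c * (t.c + 1)))

/-- `t` is the triple of the realization `σ` in `S_1`:
`L i = -(h ^ (i + 1) / h') ∂ + (b + i c) h ^ i` for `i = -1, 0, 1`. -/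
def IsTripleOne (σ : Sl2 →ₗ⁅ℂ⁆ Diff D) (t : Triple V) : Prop :=
  ∀ (i : ℤ) (hi : -1 ≤ i ∧ i ≤ 1), (σ (Sl2.L i hi) : Module.End ℂ V) = opOne D t i

/-- `t` is the triple of the realization `σ` in `S_2`:
`L (-1) = h⁻¹ (L 0 ^ 2 + L 0 - c (c + 1))`, `L 0 = -(h / h') ∂ + b` and `L 1 = h`. -/
def IsTripleTwo (σ : Sl2 →ₗ⁅ℂ⁆ Diff D) (t : Triple V) : Prop :=
  (σ (Sl2.L (-1) (by norm_num)) : Module.End ℂ V) =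
    t.h⁻¹ • (opZero D t ^ 2 + opZero D t - scal (t.c * (t.c + 1))) ∧
  (σ (Sl2.L 0 (by norm_num)) : Module.End ℂ V) = opZero D t ∧
  (σ (Sl2.L 1 (by norm_num)) : Module.End ℂ V) = t.h • 1

end Operators

/-- The relation `rel` is the graph of a bijection between `S` and `T`. -/
def IsBijectiveRel {α β : Type*} (S : Set α) (T : Set β) (rel : α → β → Prop) : Prop :=
  (∀ s ∈ S, ∃! t, t ∈ T ∧ rel s t) ∧ (∀ t ∈ T, ∃! s, s ∈ S ∧ rel s t)

end

noncomputable section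

/-! ### Constants and transcendence -/

/-! Write `A` for the image of `L 0`, an operator of order one. Its powers are independent over `V`,
so every element of `Diff(V)` is a unique left polynomial in `A` (`leftEval`). In these coordinates
`ad A` differentiates coefficients. The relation `[L 0, L (-1)] = L (-1)` yields a function `h` with
`A = -(h/h')∂ + b`. As the constants of `V` are the complex numbers, the image of `L i` must be `h^i
q_i(A)` with `q_i` a complex polynomial (`exists_eq_wt`).

Moving `A` past `h^j` shifts it to `A - j`, so each Lie relation becomes a difference equation
between the `q_i` (`wt_commutator`). For `sl(2)` the equation telescopes to `q_1(x+1) q_{-1}(x) = x²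
+ x - s`, where `s` is the Casimir value. The two degrees therefore add up to 2. This is the
trichotomy. Rescaling `h` and writing `s = c(c+1)` gives the normal forms.

Order one: bracketing with `L (-1)` upwards and with `L 1` downwards is injective on the relevant
weights, so everything is determined by `sl(2)`, and the resulting operators leave no room for a
central charge.

Order zero: `[L (-1), L 2]` fixes `q_2` up to a constant. Reaching `L 5` as `[L 1, L 4]` and as `[L
2, L 3]` gives a quadratic equation for that constant (`eq_raisePoly_two`), whose roots correspond
to `λ = c` and `λ = -c-1`. `L 1` and `L 2` generate the rest. Existence holds because `L n = E^n (A
+ nλ)` for `n ≥ 0`, with `E = h(A - λ - 1)`, which has the shape of the order one formula. An `L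
(-2)` cannot exist, by a degree count (`no_lowering`).

Order two follows from order zero through the Chevalley involution, which corresponds to `(h, b, c)
↦ (h⁻¹, -b, c)`. -/

open Polynomial in
theorem ratDeriv_eq_zero {f : RatFunc ℂ} (hf : ratDeriv f = 0) : ∃ a : ℂ, f = RatFunc.C a := by
  have hd : f.denom ≠ 0 := f.denom_ne_zero
  have h1 : derivative f.num * f.denom - f.num * derivative f.denom = 0 := by
    rcases div_eq_zero_iff.mp hf with h | h
    · exact (map_eq_zero_iff _ (RatFunc.algebraMap_injective ℂ)).mp h
    · exact absurd ((map_eq_zero_iff _ (RatFunc.algebraMap_injective ℂ)).mp h) (pow_ne_zero 2 hd)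
  -- For a reduced fraction `p/q`, `p'q = pq'` forces `q ∣ q'`, hence `q' = 0` by degree, and then
  -- `p' = 0`.
  have h2 : f.denom ∣ derivative f.denom :=
    f.isCoprime_num_denom.symm.dvd_of_dvd_mul_left
      ⟨derivative f.num, by rw [← sub_eq_zero.mp h1, mul_comm]⟩
  have h3 : derivative f.denom = 0 := by
    by_contra h
    exact absurd (degree_le_of_dvd h2 h) (not_le.mpr (degree_derivative_lt hd))
  have h4 : derivative f.num = 0 := by
    rw [h3, mul_zero, sub_zero] at h1
    exact (mul_eq_zero.mp h1).resolve_right hd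
  have h5 := derivative_eq_zero.mp h3
  have h6 : f.denom = 1 := f.monic_denom.natDegree_eq_zero.mp h5
  have h7 := eq_C_of_natDegree_eq_zero (derivative_eq_zero.mp h4)
  refine ⟨f.num.coeff 0, ?_⟩
  conv_lhs => rw [← RatFunc.num_div_denom f, h6, h7]
  simp

section Constants

variable {V : Type*} [Field V] [Algebra ℂ V] {D : Derivation ℂ V V}

/-- The constants of `ℂ(z)` and of `ℂ((z))` are the complex numbers. -/
theorem exists_algebraMap_of_der_eq_zero (hV : IsRationalFunctions D ∨ IsLaurentSeries D) {f : V}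
    (hf : D f = 0) : ∃ a : ℂ, f = algebraMap ℂ V a := by
  rcases hV with ⟨e, hC, hD⟩ | ⟨e, hC, hD⟩
  · have h : ratDeriv (e f) = 0 := by rw [← hD, hf, map_zero]
    obtain ⟨a, ha⟩ := ratDeriv_eq_zero h
    exact ⟨a, e.injective (by rw [ha, hC])⟩
  · have h : LaurentSeries.derivative ℂ (e f) = 0 := by rw [← hD, hf, map_zero]
    refine ⟨(e f).coeff 0, e.injective ?_⟩
    rw [hC]
    ext n
    by_cases hn : n = 0
    · subst hn; simp
    -- The coefficient of `z^(n-1)` in the derivative is `n a_n`.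
    · have h2 := congrArg (fun s : LaurentSeries ℂ => s.coeff (n - 1)) h
      simp only [LaurentSeries.derivative_apply, LaurentSeries.hasseDeriv_coeff,
        HahnSeries.coeff_zero, Nat.cast_one, sub_add_cancel, Ring.choose_one_right] at h2
      rw [(smul_eq_zero.mp h2).resolve_left hn]
      simp [hn]

theorem exists_der_ne_zero (hV : IsRationalFunctions D ∨ IsLaurentSeries D) :
    ∃ z : V, D z ≠ 0 := by
  rcases hV with ⟨e, hC, hD⟩ | ⟨e, hC, hD⟩
  · refine ⟨e.symm RatFunc.X, fun h => ?_⟩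
    have h2 := hD (e.symm RatFunc.X)
    rw [h, map_zero, e.apply_symm_apply] at h2
    simp [ratDeriv] at h2
  · refine ⟨e.symm (HahnSeries.single 1 1), fun h => ?_⟩
    have h2 := hD (e.symm (HahnSeries.single 1 1))
    rw [h, map_zero, e.apply_symm_apply] at h2
    have h3 := congrArg (fun s : LaurentSeries ℂ => s.coeff 0) h2
    simp at h3

end Constants

/-! ### Operators as polynomials in an operator of order one -/

section LeftEval

open Polynomial

variable {V : Type*} [Field V] [Algebra ℂ V]

/-- The operator `∑ j, f j • A ^ j` attached to the polynomial `∑ j, f j X ^ j`. -/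
def leftEval (A : Module.End ℂ V) : V[X] →ₗ[V] Module.End ℂ V :=
  Polynomial.lsum fun j => LinearMap.toSpanSingleton V (Module.End ℂ V) (A ^ j)

theorem leftEval_monomial (A : Module.End ℂ V) (j : ℕ) (f : V) :
    leftEval A (monomial j f) = f • A ^ j := by
  simp [leftEval, Polynomial.lsum_apply, Polynomial.sum_monomial_index]

theorem leftEval_eq_sum (A : Module.End ℂ V) {F : V[X]} {k : ℕ} (hF : F.natDegree < k) :
    leftEval A F = ∑ j ∈ Finset.range k, F.coeff j • A ^ j := by
  conv_lhs => rw [F.as_sum_range' k hF]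
  simp [leftEval_monomial]

theorem leftEval_map (A : Module.End ℂ V) (q : ℂ[X]) :
    leftEval A (q.map (algebraMap ℂ V)) = aeval A q := by
  induction q using Polynomial.induction_on' with
  | add p q hp hq => rw [Polynomial.map_add, map_add, map_add, hp, hq]
  | monomial n a =>
    rw [Polynomial.map_monomial, leftEval_monomial, aeval_monomial, algebraMap_smul,
      Algebra.algebraMap_eq_smul_one, smul_mul_assoc, one_mul]

/-- The derivation applied to the coefficients of a polynomial. -/
def coeffDer (D : Derivation ℂ V V) : V[X] →ₗ[ℂ] V[X] :=
  Polynomial.lsum fun j => ((monomial j : V →ₗ[V] V[X]).restrictScalars ℂ).comp (D : V →ₗ[ℂ] V)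

theorem coeffDer_monomial (D : Derivation ℂ V V) (j : ℕ) (f : V) :
    coeffDer D (monomial j f) = monomial j (D f) := by
  simp [coeffDer, Polynomial.lsum_apply, Polynomial.sum_monomial_index]

theorem coeff_coeffDer (D : Derivation ℂ V V) (F : V[X]) (j : ℕ) :
    (coeffDer D F).coeff j = D (F.coeff j) := by
  induction F using Polynomial.induction_on' with
  | add p q hp hq => simp [hp, hq]
  | monomial n a => rw [coeffDer_monomial, coeff_monomial, coeff_monomial]; split_ifs <;> simp

theorem degree_coeffDer_le (D : Derivation ℂ V V) (F : V[X]) :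
    (coeffDer D F).degree ≤ F.degree := by
  rw [degree_le_iff_coeff_zero]
  intro m hm
  rw [coeff_coeffDer, coeff_eq_zero_of_degree_lt hm, map_zero]

/-- The operator `B` satisfies the Leibniz rule with symbol `α D`. -/
def IsLeibniz (D : Derivation ℂ V V) (α : V) (B : Module.End ℂ V) : Prop :=
  ∀ (f : V) (P : Module.End ℂ V), B * (f • P) = (α * D f) • P + f • (B * P)

theorem isLeibniz_smul_der_add (D : Derivation ℂ V V) (α β : V) :
    IsLeibniz D α (α • der D + β • 1) := by
  intro f P
  rw [add_mul, add_mul, smul_mul_assoc, smul_mul_assoc, smul_mul_assoc, smul_mul_assoc,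
    der_mul_smul, one_mul, one_mul, smul_add, smul_smul, smul_add, smul_smul, smul_smul, smul_smul,
    smul_smul, mul_comm β, mul_comm α f]
  abel

theorem isLeibniz_der (D : Derivation ℂ V V) : IsLeibniz D 1 (der D) := by
  simpa using isLeibniz_smul_der_add D 1 0

/-- Passing `B` through a coefficient costs `α D` of it. Together with `leftEval_mul_self` this
shows that `ad B` acts coefficient by coefficient as `α D`. -/
theorem IsLeibniz.mul_leftEval {D : Derivation ℂ V V} {α : V} {B : Module.End ℂ V}
    (hB : IsLeibniz D α B) (F : V[X]) :
    B * leftEval B F = leftEval B (X * F + α • coeffDer D F) := by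
  induction F using Polynomial.induction_on' with
  | add p q hp hq => simp only [map_add, mul_add, smul_add, hp, hq]; abel
  | monomial n f =>
    rw [leftEval_monomial, hB, coeffDer_monomial, X_mul_monomial, smul_monomial, map_add,
      leftEval_monomial, leftEval_monomial, pow_succ', smul_eq_mul]
    exact add_comm _ _

theorem leftEval_mul_self (A : Module.End ℂ V) (F : V[X]) :
    leftEval A F * A = leftEval A (X * F) := by
  induction F using Polynomial.induction_on' with
  | add p q hp hq => simp only [map_add, mul_add, add_mul, hp, hq]
  | monomial n f =>
    rw [leftEval_monomial, X_mul_monomial, leftEval_monomial, pow_succ, smul_mul_assoc]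

/-- If `A = u B + w` with `u ≠ 0`, polynomials in `A` are polynomials of the same degree in `B`. -/
theorem IsLeibniz.exists_leftEval_eq {D : Derivation ℂ V V} {α : V} {B : Module.End ℂ V}
    (hB : IsLeibniz D α B) {u w : V} (hu : u ≠ 0) (F : V[X]) :
    ∃ G : V[X], G.degree = F.degree ∧ leftEval (u • B + w • 1) F = leftEval B G := by
  have hpow : ∀ j : ℕ, ∃ G : V[X], G.degree = j ∧ (u • B + w • 1) ^ j = leftEval B G := by
    intro j
    induction j with
    | zero =>
      refine ⟨1, by simp, ?_⟩
      rw [← monomial_zero_one, leftEval_monomial, pow_zero, pow_zero, one_smul]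
    | succ j ih =>
      obtain ⟨G, hG, hj⟩ := ih
      -- Only `u X G` reaches degree `j + 1`; the other terms have degree at most `j`.
      refine ⟨u • (X * G + α • coeffDer D G) + w • G, ?_, ?_⟩
      · have h1 : (X * G : V[X]).degree = (j + 1 : ℕ) := by
          rw [degree_mul, degree_X, hG, add_comm]; rfl
        have hlt : ((j : ℕ) : WithBot ℕ) < ((j + 1 : ℕ) : WithBot ℕ) := by
          exact_mod_cast Nat.lt_succ_self j
        have h2 : (α • coeffDer D G).degree < (X * G : V[X]).degree := by
          rw [h1]
          exact ((degree_smul_le _ _).trans ((degree_coeffDer_le D G).trans hG.le)).trans_lt hlt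
        have h3 : (u • (X * G + α • coeffDer D G)).degree = ((j + 1 : ℕ) : WithBot ℕ) := by
          rw [degree_smul_of_smul_regular _ (IsRegular.of_ne_zero hu).isSMulRegular, degree_add_eq_left_of_degree_lt h2, h1]
        rw [degree_add_eq_left_of_degree_lt, h3]
        rw [h3]
        exact ((degree_smul_le _ _).trans hG.le).trans_lt hlt
      · rw [pow_succ', hj, add_mul, smul_mul_assoc, smul_mul_assoc, one_mul, hB.mul_leftEval,
          map_add (leftEval B) (u • _), map_smul, map_smul]
  suffices H : ∀ (n : ℕ) (F : V[X]), F.natDegree ≤ n → ∃ G : V[X], G.degree = F.degree ∧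
      leftEval (u • B + w • 1) F = leftEval B G from H _ F le_rfl
  intro n
  induction n with
  | zero =>
    intro F hF
    refine ⟨F, rfl, ?_⟩
    rw [eq_C_of_natDegree_le_zero hF, ← monomial_zero_left, leftEval_monomial, leftEval_monomial,
      pow_zero, pow_zero]
  | succ n ih =>
    intro F hF
    by_cases hF0 : F.coeff (n + 1) = 0
    · refine ih F ?_
      by_contra hlt
      have : F.natDegree = n + 1 := by omega
      rw [← this, coeff_natDegree, leadingCoeff_eq_zero] at hF0
      rw [hF0, natDegree_zero] at this
      omega
    · have hdeg : F.natDegree = n + 1 := le_antisymm hF (le_natDegree_of_ne_zero hF0)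
      have hFne : F ≠ 0 := by rintro rfl; simp at hF0
      obtain ⟨G, hG, hGe⟩ := ih F.eraseLead (by
        have := eraseLead_natDegree_le F; omega)
      obtain ⟨H, hH, hHe⟩ := hpow (n + 1)
      have h1 : (F.coeff (n + 1) • H).degree = F.degree := by
        rw [degree_smul_of_smul_regular _ (IsRegular.of_ne_zero hF0).isSMulRegular, hH,
          degree_eq_natDegree hFne, hdeg]
      refine ⟨G + F.coeff (n + 1) • H, ?_, ?_⟩
      · rw [degree_add_eq_right_of_degree_lt, h1]
        rw [h1, hG]
        exact degree_eraseLead_lt hFne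
      · rw [map_add, map_smul, ← hGe, ← hHe, ← leftEval_monomial, ← map_add, ← hdeg,
          coeff_natDegree, eraseLead_add_monomial_natDegree_leadingCoeff]

/-! ### Linear independence of the powers, and order as degree. -/

variable {D : Derivation ℂ V V}

/-- The powers of an operator of order one are linearly independent over `V`. -/
theorem leftEval_injective (hD : ∃ z : V, D z ≠ 0) {a b : V} (ha : a ≠ 0) :
    Function.Injective (leftEval (a • der D + b • 1)) := by
  have : CharZero V := charZero_of_injective_algebraMap (algebraMap ℂ V).injective
  obtain ⟨z, hz⟩ := hD
  have hz0 : z ≠ 0 := by rintro rfl; simp at hz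
  -- The Euler operator `(z/z')∂` has eigenvectors `z^m` with eigenvalue `m`, so a left polynomial
  -- `F` in it sends `z^m` to `F(m) z^m`.
  have hB : IsLeibniz D (z / D z) ((z / D z) • der D) := by
    simpa using isLeibniz_smul_der_add D (z / D z) 0
  have hpow : ∀ (j m : ℕ), (((z / D z) • der D) ^ j) (z ^ m) = (m : V) ^ j * z ^ m := by
    intro j m
    induction j with
    | zero => simp
    | succ j ih =>
      rw [pow_succ', Module.End.mul_apply, ih]
      change z / D z * D ((m : V) ^ j * z ^ m) = _
      rw [Derivation.leibniz, ← Nat.cast_pow, Derivation.map_natCast, Derivation.leibniz_pow,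
        smul_zero, add_zero, smul_eq_mul, smul_eq_mul, nsmul_eq_mul]
      rcases m with _ | m
      · simp
      · push_cast
        field_simp
        ring
  have heval : ∀ (F : V[X]) (m : ℕ), (leftEval ((z / D z) • der D) F) (z ^ m) =
      F.eval (m : V) * z ^ m := by
    intro F m
    induction F using Polynomial.induction_on' with
    | add p q hp hq => rw [map_add, LinearMap.add_apply, hp, hq, eval_add, add_mul]
    | monomial n f =>
      rw [leftEval_monomial, LinearMap.smul_apply, hpow, eval_monomial, smul_eq_mul, mul_assoc]
  rw [injective_iff_map_eq_zero]
  intro F hF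
  obtain ⟨G, hG, hGe⟩ := hB.exists_leftEval_eq (u := a * (D z / z)) (w := b)
    (mul_ne_zero ha (div_ne_zero hz hz0)) F
  have hA : (a * (D z / z)) • ((z / D z) • der D) + b • 1 = a • der D + b • 1 := by
    rw [smul_smul, mul_assoc, div_mul_div_comm, mul_comm z, div_self (mul_ne_zero hz hz0), mul_one]
  rw [hA, hF] at hGe
  -- `G` vanishes at every natural number; equality of degrees then gives `F = 0`.
  have hG0 : G = 0 := by
    refine eq_zero_of_infinite_isRoot G
      (Set.infinite_of_injective_forall_mem (Nat.cast_injective (R := V)) fun m => ?_)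
    have h := heval G m
    rw [← hGe, LinearMap.zero_apply] at h
    exact (mul_eq_zero.mp h.symm).resolve_right (pow_ne_zero m hz0)
  rwa [hG0, degree_zero, eq_comm, degree_eq_bot] at hG

theorem leftEval_der_injective (hD : ∃ z : V, D z ≠ 0) : Function.Injective (leftEval (der D)) := by
  simpa using leftEval_injective hD (a := 1) (b := 0) one_ne_zero

theorem mem_Diff_iff {P : Module.End ℂ V} : P ∈ Diff D ↔ ∃ F, leftEval (der D) F = P := by
  change P ∈ Submodule.span V (Set.range fun j : ℕ => der D ^ j) ↔ _
  rw [← LinearMap.mem_range]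
  constructor
  · intro h
    refine (Submodule.span_le.mpr ?_) h
    rintro _ ⟨j, rfl⟩
    exact ⟨monomial j 1, by simp [leftEval_monomial]⟩
  · rintro ⟨F, rfl⟩
    rw [leftEval_eq_sum _ (Nat.lt_succ_self _)]
    exact Submodule.sum_mem _ fun j _ => Submodule.smul_mem _ _ (Submodule.subset_span ⟨j, rfl⟩)

theorem hasOrder_iff {P : Module.End ℂ V} {k : ℕ} :
    HasOrder D P k ↔ ∃ F : V[X], F.degree = k ∧ leftEval (der D) F = P := by
  constructor
  · rintro ⟨ξ, hξ, rfl⟩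
    refine ⟨∑ j ∈ Finset.range (k + 1), monomial j (ξ j), ?_, by simp [leftEval_monomial]⟩
    rw [Finset.sum_range_succ, degree_add_eq_right_of_degree_lt, degree_monomial _ hξ]
    rw [degree_monomial _ hξ]
    refine (degree_sum_le _ _).trans_lt ((Finset.sup_lt_iff (WithBot.bot_lt_coe k)).mpr ?_)
    intro j hj
    exact (degree_monomial_le _ _).trans_lt (WithBot.coe_lt_coe.mpr (Finset.mem_range.mp hj))
  · rintro ⟨F, hF, rfl⟩
    have hn := natDegree_eq_of_degree_eq_some hF
    refine ⟨F.coeff, ?_, leftEval_eq_sum _ (by omega)⟩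
    rw [← hn, coeff_natDegree, Ne, leadingCoeff_eq_zero]
    rintro rfl
    simp at hF

variable {a b : V}

theorem exists_leftEval_der_eq (ha : a ≠ 0) (F : V[X]) : ∃ G : V[X], G.degree = F.degree ∧
    leftEval (a • der D + b • 1) F = leftEval (der D) G :=
  (isLeibniz_der D).exists_leftEval_eq ha F

theorem exists_leftEval_eq_der (ha : a ≠ 0) (F : V[X]) : ∃ G : V[X], G.degree = F.degree ∧
    leftEval (a • der D + b • 1) G = leftEval (der D) F := by
  -- Solve `A = a∂ + b` for `∂ = a⁻¹ A - a⁻¹ b`.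
  obtain ⟨G, hG, h⟩ := (isLeibniz_smul_der_add D a b).exists_leftEval_eq (inv_ne_zero ha) F
    (w := -(a⁻¹ * b))
  refine ⟨G, hG, h.symm.trans ?_⟩
  congr 2
  rw [smul_add, smul_smul, smul_smul, inv_mul_cancel₀ ha, one_smul, add_assoc, ← add_smul, add_neg_cancel,
    zero_smul, add_zero]

theorem mem_Diff_iff_leftEval (ha : a ≠ 0) {P : Module.End ℂ V} :
    P ∈ Diff D ↔ ∃ F, leftEval (a • der D + b • 1) F = P := by
  rw [mem_Diff_iff]
  constructor
  · rintro ⟨F, rfl⟩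
    obtain ⟨G, -, h⟩ := exists_leftEval_eq_der (b := b) ha F
    exact ⟨G, h⟩
  · rintro ⟨F, rfl⟩
    obtain ⟨G, -, h⟩ := exists_leftEval_der_eq (D := D) (b := b) ha F
    exact ⟨G, h.symm⟩

theorem hasOrder_leftEval_iff (hD : ∃ z : V, D z ≠ 0) (ha : a ≠ 0) {F : V[X]} {k : ℕ} :
    HasOrder D (leftEval (a • der D + b • 1) F) k ↔ F.degree = k := by
  obtain ⟨G, hG, h⟩ := exists_leftEval_der_eq (D := D) (b := b) ha F
  rw [hasOrder_iff, h, ← hG]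
  constructor
  · rintro ⟨G', hG', h'⟩
    rw [← leftEval_der_injective hD h', hG']
  · exact fun h' => ⟨G, h', rfl⟩

theorem hasOrder_one_iff {P : Module.End ℂ V} :
    HasOrder D P 1 ↔ ∃ a b : V, a ≠ 0 ∧ P = a • der D + b • 1 := by
  constructor
  · rintro ⟨ξ, hξ, rfl⟩
    refine ⟨ξ 1, ξ 0, hξ, ?_⟩
    simp [Finset.sum_range_succ, add_comm]
  · rintro ⟨a, b, ha, rfl⟩
    refine ⟨fun j => if j = 0 then b else a, by simpa using ha, ?_⟩
    simp [Finset.sum_range_succ, add_comm]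

end LeftEval

/-! ### Homogeneous operators -/

section Weight

open Polynomial

variable {V : Type*} [Field V] [Algebra ℂ V] {D : Derivation ℂ V V}

theorem end_neg_smul (f : V) (P : Module.End ℂ V) : (-f) • P = -(f • P) := by
  ext x
  change -f * P x = -(f * P x)
  ring

/-- The operator `h ^ i q(A)` with `A = -(h / h') ∂ + b`. -/
def wt (D : Derivation ℂ V V) (t : Triple V) (i : ℤ) : ℂ[X] →ₗ[ℂ] Module.End ℂ V where
  toFun q := t.h ^ i • aeval (opZero D t) q
  map_add' p q := by rw [map_add, smul_add]
  map_smul' a q := by rw [map_smul, smul_comm, RingHom.id_apply]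

theorem wt_apply (t : Triple V) (i : ℤ) (q : ℂ[X]) :
    wt D t i q = t.h ^ i • aeval (opZero D t) q := rfl

theorem wt_zero_X (t : Triple V) : wt D t 0 X = opZero D t := by
  rw [wt_apply, zpow_zero, one_smul, aeval_X]

variable {t : Triple V}

theorem Triple.h_ne_zero (ht : D t.h ≠ 0) : t.h ≠ 0 := by
  intro h; rw [h, map_zero] at ht; exact ht rfl

theorem Triple.symbol_ne_zero (ht : D t.h ≠ 0) : -(t.h / D t.h) ≠ 0 :=
  neg_ne_zero.mpr (div_ne_zero (Triple.h_ne_zero ht) ht)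

/-- The symbol of `A` acts on `h^i` as `-i`. This is the source of the shift `A h^i = h^i (A - i)`.
-/
theorem Triple.der_zpow (ht : D t.h ≠ 0) (i : ℤ) :
    -(t.h / D t.h) * D (t.h ^ i) = -(i : V) * t.h ^ i := by
  have h0 := Triple.h_ne_zero ht
  rw [Derivation.leibniz_zpow, zsmul_eq_mul, smul_eq_mul, zpow_sub_one₀ h0]
  field_simp

theorem opZero_pow_mul_zpow (ht : D t.h ≠ 0) (n : ℕ) (j : ℤ) (Q : Module.End ℂ V) :
    opZero D t ^ n * (t.h ^ j • Q) =
      t.h ^ j • ((opZero D t - algebraMap ℂ (Module.End ℂ V) j) ^ n * Q) := by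
  induction n with
  | zero => simp
  | succ n ih =>
    have hB : IsLeibniz D (-(t.h / D t.h)) (opZero D t) := isLeibniz_smul_der_add D _ _
    rw [pow_succ', mul_assoc, ih, hB, Triple.der_zpow ht, pow_succ', mul_assoc, sub_mul, smul_sub,
      neg_mul, end_neg_smul, mul_comm (j : V), mul_smul,
      neg_add_eq_sub]
    congr 2
    rw [Algebra.algebraMap_eq_smul_one, smul_mul_assoc, one_mul, ← map_intCast (algebraMap ℂ V),
      algebraMap_smul]

theorem aeval_opZero_mul_zpow (ht : D t.h ≠ 0) (p : ℂ[X]) (j : ℤ) (Q : Module.End ℂ V) :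
    aeval (opZero D t) p * (t.h ^ j • Q) =
      t.h ^ j • (aeval (opZero D t) (p.comp (X - C (j : ℂ))) * Q) := by
  rw [aeval_comp, map_sub, aeval_X, aeval_C]
  induction p using Polynomial.induction_on' with
  | add p q hp hq => simp only [map_add, add_mul, smul_add, hp, hq]
  | monomial n a =>
    rw [aeval_monomial, aeval_monomial, mul_assoc, opZero_pow_mul_zpow ht,
      Algebra.algebraMap_eq_smul_one, smul_mul_assoc, one_mul, smul_mul_assoc, one_mul,
      smul_mul_assoc, smul_comm]

/-- Weights add and the left polynomial is shifted by the weight it crosses. Combined with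
`wt_injective`, this turns operator identities into identities in `ℂ[X]`. -/
theorem wt_mul (ht : D t.h ≠ 0) (i j : ℤ) (p q : ℂ[X]) :
    wt D t i p * wt D t j q = wt D t (i + j) (p.comp (X - C (j : ℂ)) * q) := by
  rw [wt_apply, wt_apply, wt_apply, smul_mul_assoc, aeval_opZero_mul_zpow ht, smul_smul,
    zpow_add₀ (Triple.h_ne_zero ht), map_mul]

/-- The polynomial `r` with `[h ^ i p(A), h ^ j q(A)] = h ^ (i + j) r(A)`. -/
def wtBracket (i j : ℤ) (p q : ℂ[X]) : ℂ[X] :=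
  p.comp (X - C (j : ℂ)) * q - q.comp (X - C (i : ℂ)) * p

theorem wt_commutator (ht : D t.h ≠ 0) (i j : ℤ) (p q : ℂ[X]) :
    wt D t i p * wt D t j q - wt D t j q * wt D t i p = wt D t (i + j) (wtBracket i j p q) := by
  rw [wt_mul ht, wt_mul ht, add_comm j i, ← map_sub, wtBracket]

theorem wt_eq_leftEval (t : Triple V) (i : ℤ) (q : ℂ[X]) :
    wt D t i q = leftEval ((-(t.h / D t.h)) • der D + t.b • 1)
      (t.h ^ i • q.map (algebraMap ℂ V)) := by
  rw [map_smul, leftEval_map]; rfl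

theorem wt_mem_Diff (ht : D t.h ≠ 0) (i : ℤ) (q : ℂ[X]) : wt D t i q ∈ Diff D :=
  (mem_Diff_iff_leftEval (Triple.symbol_ne_zero ht)).mpr ⟨_, (wt_eq_leftEval t i q).symm⟩

theorem hasOrder_wt_iff (ht : D t.h ≠ 0) {i : ℤ} {q : ℂ[X]} {k : ℕ} :
    HasOrder D (wt D t i q) k ↔ q.degree = k := by
  rw [wt_eq_leftEval, hasOrder_leftEval_iff ⟨_, ht⟩ (Triple.symbol_ne_zero ht),
    degree_smul_of_smul_regular _
      (IsRegular.of_ne_zero (zpow_ne_zero i (Triple.h_ne_zero ht))).isSMulRegular, degree_map]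

theorem wt_injective (ht : D t.h ≠ 0) (i : ℤ) : Function.Injective (wt D t i) := by
  intro p q h
  rw [wt_eq_leftEval, wt_eq_leftEval] at h
  exact map_injective _ (algebraMap ℂ V).injective
    (smul_right_injective _ (zpow_ne_zero i (Triple.h_ne_zero ht))
      (leftEval_injective ⟨_, ht⟩ (Triple.symbol_ne_zero ht) h))

theorem der_mul_leftEval_sub {a b : V} (F : V[X]) :
    (a • der D + b • 1) * leftEval (a • der D + b • 1) F -
      leftEval (a • der D + b • 1) F * (a • der D + b • 1) =
    leftEval (a • der D + b • 1) (a • coeffDer D F) := by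
  rw [(isLeibniz_smul_der_add D a b).mul_leftEval, leftEval_mul_self, map_add, add_sub_cancel_left]

/-- Eigenvectors of `ad A` in terms of the coefficients of the powers of `A`. -/
theorem coeff_of_commutator_eq_smul (hD : ∃ z : V, D z ≠ 0) {a b : V} (ha : a ≠ 0) {F : V[X]} {μ : ℂ}
    (h : (a • der D + b • 1) * leftEval (a • der D + b • 1) F -
      leftEval (a • der D + b • 1) F * (a • der D + b • 1) =
        μ • leftEval (a • der D + b • 1) F) (j : ℕ) :
    a * D (F.coeff j) = algebraMap ℂ V μ * F.coeff j := by
  rw [der_mul_leftEval_sub, ← algebraMap_smul V μ (leftEval _ F),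
    ← (leftEval (a • der D + b • 1)).map_smul (algebraMap ℂ V μ)] at h
  have h2 := congrArg (fun G => coeff G j) (leftEval_injective hD ha h)
  simpa [coeff_coeffDer, Algebra.smul_def] using h2

/-- An eigenvector of `ad A` for `-i` has coefficients `f` with `(h/h') f' = i f`. Then `h^(-i) f`
has derivative zero, so it is a complex number. -/
theorem exists_eq_wt (hV : IsRationalFunctions D ∨ IsLaurentSeries D) (ht : D t.h ≠ 0) {i : ℤ}
    {P : Module.End ℂ V} (hP : P ∈ Diff D)
    (h : opZero D t * P - P * opZero D t = (-(i : ℂ)) • P) : ∃ q, P = wt D t i q := by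
  obtain ⟨F, rfl⟩ := (mem_Diff_iff_leftEval (b := t.b) (Triple.symbol_ne_zero ht)).mp hP
  have h0 := Triple.h_ne_zero ht
  have hF := coeff_of_commutator_eq_smul ⟨_, ht⟩ (Triple.symbol_ne_zero ht) h
  have hc : ∀ j, ∃ c : ℂ, algebraMap ℂ V c = (t.h ^ (-i) • F).coeff j := by
    intro j
    have hz := Triple.der_zpow ht (-i)
    have hj := hF j
    obtain ⟨c, hc⟩ := exists_algebraMap_of_der_eq_zero hV (f := t.h ^ (-i) * F.coeff j) (by
      rw [Derivation.leibniz, smul_eq_mul, smul_eq_mul]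
      refine (mul_eq_zero.mp ?_).resolve_left (Triple.symbol_ne_zero ht)
      push_cast at hz
      rw [map_neg, map_intCast] at hj
      linear_combination t.h ^ (-i) * hj + F.coeff j * hz)
    exact ⟨c, by rw [coeff_smul, smul_eq_mul, hc]⟩
  have hl : t.h ^ (-i) • F ∈ lifts (algebraMap ℂ V) := by
    rw [lifts_iff_coeff_lifts]
    exact hc
  obtain ⟨q, hq⟩ := (mem_lifts _).mp hl
  refine ⟨q, ?_⟩
  rw [wt_eq_leftEval, hq, smul_smul, ← zpow_add₀ h0, add_neg_cancel, zpow_zero, one_smul]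

/-! ### Rescaling and inverting `h`. -/

/-- The triple with the function `h` multiplied by a constant. -/
def Triple.rescale (μ : ℂ) (t : Triple V) : Triple V := ⟨algebraMap ℂ V μ * t.h, t.b, t.c⟩

theorem der_rescale {μ : ℂ} : D (t.rescale μ).h = algebraMap ℂ V μ * D t.h := by
  simp [Triple.rescale]

theorem der_rescale_ne_zero (ht : D t.h ≠ 0) {μ : ℂ} (hμ : μ ≠ 0) : D (t.rescale μ).h ≠ 0 := by
  rw [der_rescale]
  exact mul_ne_zero ((_root_.map_ne_zero _).mpr hμ) ht

theorem opZero_rescale {μ : ℂ} (hμ : μ ≠ 0) : opZero D (t.rescale μ) = opZero D t := by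
  rw [opZero, opZero, der_rescale]
  simp only [Triple.rescale]
  rw [mul_div_mul_left _ _ ((_root_.map_ne_zero _).mpr hμ)]

theorem wt_rescale {μ : ℂ} (hμ : μ ≠ 0) (i : ℤ) (q : ℂ[X]) :
    wt D (t.rescale μ) i q = wt D t i (μ ^ i • q) := by
  rw [map_smul, wt_apply, wt_apply, opZero_rescale hμ, Triple.rescale, mul_zpow, mul_smul,
    ← map_zpow₀, algebraMap_smul]

/-- The triple `(h⁻¹, -b, c)`. -/
def Triple.dual {V : Type*} [Field V] (t : Triple V) : Triple V := ⟨t.h⁻¹, -t.b, t.c⟩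

theorem Triple.dual_dual {V : Type*} [Field V] (t : Triple V) : t.dual.dual = t := by
  simp [Triple.dual]

theorem der_dual : D t.dual.h = -(t.h⁻¹ ^ 2 * D t.h) := by
  simp [Triple.dual, Derivation.leibniz_inv]

theorem der_dual_ne_zero (ht : D t.h ≠ 0) : D t.dual.h ≠ 0 := by
  rw [der_dual]
  exact neg_ne_zero.mpr (mul_ne_zero (pow_ne_zero 2 (inv_ne_zero (Triple.h_ne_zero ht))) ht)

theorem opZero_dual (ht : D t.h ≠ 0) : opZero D t.dual = -opZero D t := by
  have h0 := Triple.h_ne_zero ht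
  rw [opZero, opZero, der_dual, neg_add, ← end_neg_smul, ← end_neg_smul]
  simp only [Triple.dual]
  congr 2
  field_simp

/-- Inverting `h` negates both the weight and `A`, which is what the Chevalley involution requires.
-/
theorem wt_dual (ht : D t.h ≠ 0) (i : ℤ) (q : ℂ[X]) :
    wt D t.dual i q = wt D t (-i) (q.comp (-X)) := by
  rw [wt_apply, wt_apply, opZero_dual ht, aeval_comp, map_neg, aeval_X]
  simp [Triple.dual]

end Weight

/-! ### The polynomial identities -/

section PolynomialIdentities

open Polynomial

theorem eval_wtBracket (i j : ℤ) (p q : ℂ[X]) (x : ℂ) :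
    (wtBracket i j p q).eval x = p.eval (x - j) * q.eval x - q.eval (x - i) * p.eval x := by
  simp [wtBracket]

theorem eq_zero_of_eval_sub_natCast {p : ℂ[X]} (a ε : ℂ) (hε : ε ≠ 0)
    (h : ∀ n : ℕ, p.eval (a + ε * n) = 0) : p = 0 :=
  eq_zero_of_infinite_isRoot p
    (Set.infinite_of_injective_forall_mem (f := fun n : ℕ => a + ε * n)
      (fun m n hmn => by simpa [hε] using hmn) h)

/-- A polynomial is determined by its differences up to a constant. -/
theorem exists_eval_eq_add_of_sub_eq {p e : ℂ[X]}
    (h : ∀ x, p.eval x - p.eval (x - 1) = e.eval x - e.eval (x - 1)) : ∃ κ, p = e + C κ := by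
  refine ⟨(p - e).eval 0, ?_⟩
  rw [← sub_eq_zero]
  refine eq_zero_of_eval_sub_natCast 0 1 one_ne_zero fun n => ?_
  induction n with
  | zero => simp
  | succ n ih =>
    have h1 := h (n + 1)
    rw [add_sub_cancel_right] at h1
    simp only [eval_sub, eval_add, eval_C, zero_add, one_mul] at ih ⊢
    push_cast
    linear_combination ih + h1

/-! #### Constants in the fundamental domain -/

theorem CSl.exists_mul_add_one_eq (s : ℂ) : ∃ c ∈ CSl, c * (c + 1) = s := by
  -- Complete the square with `d = c + 1/2`; `CSl` selects one of `d` and `-d`.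
  obtain ⟨d, hd⟩ := IsAlgClosed.exists_pow_nat_eq (s + 1 / 4) (n := 2) (by norm_num)
  have key : ∀ d : ℂ, d ^ 2 = s + 1 / 4 → (0 < d.re ∨ d.re = 0 ∧ 0 ≤ d.im) →
      ∃ c ∈ CSl, c * (c + 1) = s := by
    intro d hd h
    refine ⟨d - 1 / 2, ?_, by linear_combination hd⟩
    have h1 : (d - 1 / 2).re = d.re - 1 / 2 := by simp
    have h2 : (d - 1 / 2).im = d.im := by simp
    change _ ∨ _
    rw [h1, h2]
    rcases h with h | ⟨h, h'⟩
    · left; linarith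
    · right; exact ⟨by linarith, h'⟩
  have hd' : (-d) ^ 2 = s + 1 / 4 := by rw [neg_sq, hd]
  rcases lt_trichotomy d.re 0 with h | h | h
  · exact key _ hd' (Or.inl (by simpa using h))
  · rcases le_total 0 d.im with h' | h'
    · exact key _ hd (Or.inr ⟨h, h'⟩)
    · exact key _ hd' (Or.inr ⟨by simpa using h, by simpa using h'⟩)
  · exact key _ hd (Or.inl h)

theorem CSl.eq_of_add_eq_neg_one {c d : ℂ} (hc : c ∈ CSl) (hd : d ∈ CSl) (h : c = -d - 1) :
    c = d := by
  have h1 : c.re = -d.re - 1 := by rw [h]; simp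
  have h2 : c.im = -d.im := by rw [h]; simp
  rcases hc with hc | ⟨hc, hc'⟩ <;> rcases hd with hd | ⟨hd, hd'⟩
  · linarith
  · linarith
  · linarith
  · exact Complex.ext (by linarith) (by linarith)

theorem eq_or_eq_neg_sub_one {c d : ℂ} (h : c * (c + 1) = d * (d + 1)) : c = d ∨ c = -d - 1 := by
  have h1 : (c - d) * (c + d + 1) = 0 := by linear_combination h
  rcases mul_eq_zero.mp h1 with h2 | h2
  · left; linear_combination h2
  · right; linear_combination h2

theorem CSl.eq_of_mul_add_one_eq {c d : ℂ} (hc : c ∈ CSl) (hd : d ∈ CSl)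
    (h : c * (c + 1) = d * (d + 1)) : c = d :=
  (eq_or_eq_neg_sub_one h).elim id (CSl.eq_of_add_eq_neg_one hc hd)

/-! #### Realizations of `sl(2)` -/

/-- With `u(x) = p(x+1) m(x)` the hypothesis reads `u(x) - u(x-1) = 2x`. The constant `s` is the
value of the Casimir element `L 0 ^ 2 + L 0 - L 1 L (-1)`. -/
theorem exists_comp_mul_eq {p m : ℂ[X]} (h : wtBracket 1 (-1) p m = (2 : ℂ) • X) :
    ∃ s : ℂ, p.comp (X + C 1) * m = X ^ 2 + X - C s := by
  obtain ⟨κ, hκ⟩ := exists_eval_eq_add_of_sub_eq (p := p.comp (X + C 1) * m) (e := X ^ 2 + X) (by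
    intro x
    have h1 := congrArg (eval x) h
    rw [eval_wtBracket] at h1
    simp at h1 ⊢
    linear_combination h1)
  exact ⟨-κ, by rw [hκ, map_neg, sub_neg_eq_add]⟩

theorem natDegree_add_natDegree_eq_two {p m : ℂ[X]} (h : wtBracket 1 (-1) p m = (2 : ℂ) • X) :
    p.natDegree + m.natDegree = 2 := by
  obtain ⟨s, hs⟩ := exists_comp_mul_eq h
  have h1 : (X ^ 2 + X - C s : ℂ[X]).natDegree = 2 := by compute_degree!
  have h0 : p.comp (X + C 1) * m ≠ 0 := by
    rw [hs]; intro h; rw [h] at h1; simp at h1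
  rw [← hs, natDegree_mul (left_ne_zero_of_mul h0) (right_ne_zero_of_mul h0), natDegree_comp,
    natDegree_X_add_C, mul_one] at h1
  exact h1

theorem normal_form_zero {p m : ℂ[X]} (h : wtBracket 1 (-1) p m = (2 : ℂ) • X)
    (hm : m.degree = (0 : ℕ)) : ∃ ν c : ℂ, ν ≠ 0 ∧ c ∈ CSl ∧ m = ν ^ (-1 : ℤ) • (1 : ℂ[X]) ∧
      p = ν ^ (1 : ℤ) • (X ^ 2 - X - C (c * (c + 1))) := by
  obtain ⟨s, hs⟩ := exists_comp_mul_eq h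
  obtain ⟨c, hc, rfl⟩ := CSl.exists_mul_add_one_eq s
  obtain ⟨μ, rfl⟩ : ∃ μ, m = C μ := ⟨_, eq_C_of_degree_le_zero hm.le⟩
  have hμ : μ ≠ 0 := by rintro rfl; simp at hm
  refine ⟨μ⁻¹, c, inv_ne_zero hμ, hc, by simp [smul_eq_C_mul], ?_⟩
  refine Polynomial.funext fun x => ?_
  -- Evaluating at `x - 1` undoes the shift in `p(x+1)`.
  have h1 := congrArg (eval (x - 1)) hs
  simp at h1 ⊢
  field_simp
  linear_combination h1

theorem normal_form_one {p m : ℂ[X]} (h : wtBracket 1 (-1) p m = (2 : ℂ) • X)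
    (hm : m.degree = (1 : ℕ)) : ∃ ν c : ℂ, ν ≠ 0 ∧ m = ν ^ (-1 : ℤ) • (X - C c) ∧
      p = ν ^ (1 : ℤ) • (X + C c) := by
  obtain ⟨s, hs⟩ := exists_comp_mul_eq h
  have hp : p.natDegree = 1 := by
    have := natDegree_add_natDegree_eq_two h
    rw [natDegree_eq_of_degree_eq_some hm] at this
    omega
  obtain ⟨μ, β, rfl⟩ : ∃ μ β, m = C μ * X + C β :=
    ⟨_, _, eq_X_add_C_of_degree_le_one hm.le⟩
  obtain ⟨ν, γ, rfl⟩ : ∃ ν γ, p = C ν * X + C γ :=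
    ⟨_, _, eq_X_add_C_of_degree_le_one (degree_le_of_natDegree_le hp.le)⟩
  have e := fun x => congrArg (eval x) hs
  simp at e
  -- Three values of a quadratic identity isolate its coefficients: `h1` is that of `x²`, `h2` that
  -- of `x`.
  have e0 := e 0
  have e1 := e 1
  have e2 := e (-1)
  have h1 : ν * μ = 1 := by linear_combination (e1 + e2) / 2 - e0
  have hν : ν ≠ 0 := left_ne_zero_of_mul_eq_one h1
  have hμ : μ = ν⁻¹ := eq_inv_of_mul_eq_one_right h1
  have h2 : ν * β + (ν + γ) * μ = 1 := by linear_combination (e1 - e2) / 2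
  refine ⟨ν, γ / ν, hν, ?_, ?_⟩
  · refine Polynomial.funext fun x => ?_
    simp
    rw [hμ] at h2 ⊢
    field_simp at h2 ⊢
    linear_combination h2
  · refine Polynomial.funext fun x => ?_
    simp
    field_simp

/-! #### Uniqueness in the case of order one -/

/-- At `x = c` the term with `q(x+1)` drops out, so `q(c) = 0`. Going down, the factor of `q(c-n)`
is `-(i+n) ≠ 0`, so `q` vanishes at all `c - n`. -/
theorem eq_zero_of_wtBracket_lower {q : ℂ[X]} {c : ℂ} {i : ℕ} (hi : i ≠ 0)
    (h : wtBracket (-1) i (X - C c) q = 0) : q = 0 := by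
  refine eq_zero_of_eval_sub_natCast c (-1) (by norm_num) fun n => ?_
  have hne : ∀ n : ℕ, (-(i : ℂ) - n) ≠ 0 := fun n => by
    have : (i : ℂ) + n ≠ 0 := by exact_mod_cast (by omega : i + n ≠ 0)
    intro h; apply this; linear_combination -h
  have e := fun x => congrArg (eval x) h
  simp [eval_wtBracket] at e
  induction n with
  | zero =>
    refine (mul_eq_zero.mp ?_).resolve_left (hne 0)
    simp only [Nat.cast_zero, mul_zero, add_zero]
    linear_combination e c
  | succ n ih =>
    have e1 := e (c + -1 * ((n + 1 : ℕ) : ℂ))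
    refine (mul_eq_zero.mp ?_).resolve_left (hne (n + 1))
    rw [show c + -1 * ((n + 1 : ℕ) : ℂ) + 1 = c + -1 * n by push_cast; ring, ih] at e1
    push_cast at e1 ⊢
    linear_combination e1

/-- Mirror image of `eq_zero_of_wtBracket_lower`: the zeros propagate upwards from `-c`. -/
theorem eq_zero_of_wtBracket_raise {q : ℂ[X]} {c : ℂ} {i : ℕ} (hi : i ≠ 0)
    (h : wtBracket 1 (-i) (X + C c) q = 0) : q = 0 := by
  refine eq_zero_of_eval_sub_natCast (-c) 1 one_ne_zero fun n => ?_
  have hne : ∀ n : ℕ, ((i : ℂ) + n) ≠ 0 := fun n => by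
    exact_mod_cast (by omega : i + n ≠ 0)
  have e := fun x => congrArg (eval x) h
  simp [eval_wtBracket] at e
  induction n with
  | zero =>
    refine (mul_eq_zero.mp ?_).resolve_left (hne 0)
    simp only [Nat.cast_zero, mul_zero, add_zero]
    linear_combination e (-c)
  | succ n ih =>
    have e1 := e (-c + 1 * ((n + 1 : ℕ) : ℂ))
    refine (mul_eq_zero.mp ?_).resolve_left (hne (n + 1))
    rw [show -c + 1 * ((n + 1 : ℕ) : ℂ) - 1 = -c + 1 * n by push_cast; ring, ih] at e1
    push_cast at e1 ⊢
    linear_combination e1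

theorem wtBracket_sub_right (i j : ℤ) (p q r : ℂ[X]) :
    wtBracket i j p (q - r) = wtBracket i j p q - wtBracket i j p r := by
  simp only [wtBracket, sub_comp]
  ring

theorem wtBracket_swap (i j : ℤ) (p q : ℂ[X]) : wtBracket i j p q = -wtBracket j i q p := by
  simp only [wtBracket]
  ring

/-- The polynomials `x + i c` that realize the Witt algebra. -/
theorem wtBracket_order_one (c : ℂ) (i j : ℤ) :
    wtBracket i j (X + C (i * c)) (X + C (j * c)) =
      ((i : ℂ) - j) • (X + C (((i + j : ℤ) : ℂ) * c)) := by
  refine Polynomial.funext fun x => ?_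
  rw [eval_wtBracket]
  simp
  ring

/-! #### Emptiness -/

/-- Let `r(x) = x² - x - s`. Multiplying the equation by `r(x+1)` makes it telescope: `r(x+2) r(x+1)
q(x)` has difference `a r(x+1)`, so it is a polynomial of degree exactly 3. But it is either zero or
of degree at least 4. -/
theorem no_lowering {q : ℂ[X]} {s a : ℂ} (ha : a ≠ 0)
    (h : wtBracket 1 (-2) (X ^ 2 - X - C s) q = C a) : False := by
  have h4 : ((X ^ 2 + 3 * X + C (2 - s)) * (X ^ 2 + X - C s) : ℂ[X]).natDegree = 4 := by
    rw [natDegree_mul']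
    · rw [show (X ^ 2 + 3 * X + C (2 - s) : ℂ[X]).natDegree = 2 by compute_degree!,
        show (X ^ 2 + X - C s : ℂ[X]).natDegree = 2 by compute_degree!]
    · rw [show (X ^ 2 + 3 * X + C (2 - s) : ℂ[X]).leadingCoeff = 1 by monicity!,
        show (X ^ 2 + X - C s : ℂ[X]).leadingCoeff = 1 by monicity!]
      norm_num
  obtain ⟨κ, hκ⟩ := exists_eval_eq_add_of_sub_eq
    (p := (X ^ 2 + 3 * X + C (2 - s)) * (X ^ 2 + X - C s) * q)
    (e := C (a / 3) * (X ^ 3 + 3 * X ^ 2 + C (2 - 3 * s) * X)) (by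
      intro x
      have e := congrArg (eval x) h
      rw [eval_wtBracket] at e
      simp at e ⊢
      linear_combination (x ^ 2 + x - s) * e)
  have ha3 : a / 3 ≠ 0 := div_ne_zero ha (by norm_num)
  have h3 : (C (a / 3) * (X ^ 3 + 3 * X ^ 2 + C (2 - 3 * s) * X) + C κ : ℂ[X]).natDegree = 3 := by
    compute_degree!
  have hq : q ≠ 0 := by
    rintro rfl
    rw [← hκ] at h3
    simp at h3
  have h40 : ((X ^ 2 + 3 * X + C (2 - s)) * (X ^ 2 + X - C s) : ℂ[X]) ≠ 0 := by
    intro h; rw [h] at h4; simp at h4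
  rw [← hκ, natDegree_mul h40 hq, h4] at h3
  omega

/-- The substitution `x ↦ -x` reduces this to `no_lowering`. -/
theorem no_raising {q : ℂ[X]} {s a : ℂ} (ha : a ≠ 0)
    (h : wtBracket (-1) 2 (X ^ 2 + X - C s) q = C a) : False := by
  refine no_lowering (q := q.comp (-X)) (s := s) ha ?_
  refine Polynomial.funext fun x => ?_
  have e := congrArg (eval (-x)) h
  simp [eval_wtBracket] at e ⊢
  rw [show 1 - x = -x + 1 by ring]
  linear_combination e

/-! #### The realizations with `L (-1)` of order zero -/

/-- The polynomial `(x - l - n) ⋯ (x - l - 1)`. -/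
def shiftPoch (l : ℂ) (n : ℕ) : ℂ[X] := (ascPochhammer ℂ n).comp (X - C (l + n))

theorem shiftPoch_zero (l : ℂ) : shiftPoch l 0 = 1 := by simp [shiftPoch]

theorem eval_shiftPoch_succ (l : ℂ) (n : ℕ) (x : ℂ) :
    (shiftPoch l (n + 1)).eval x = (x - l - n - 1) * (shiftPoch l n).eval x := by
  simp only [shiftPoch, ascPochhammer_succ_left, eval_comp, eval_mul, eval_X, eval_sub, eval_C,
    eval_add, eval_one]
  rw [show x - (l + ((n + 1 : ℕ) : ℂ)) + 1 = x - (l + n) by push_cast; ring]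
  push_cast
  ring

/-- This is `E^i E^j = E^(i+j)` for `E = h(A - l - 1)`, since `E^n = h^n (shiftPoch l n)(A)`. -/
theorem eval_shiftPoch_mul (l : ℂ) (i j : ℕ) (x : ℂ) :
    (shiftPoch l i).eval (x - j) * (shiftPoch l j).eval x = (shiftPoch l (i + j)).eval x := by
  induction i with
  | zero => simp [shiftPoch_zero]
  | succ i ih =>
    rw [eval_shiftPoch_succ, mul_assoc, ih, add_right_comm, eval_shiftPoch_succ]
    push_cast
    ring

theorem eval_shiftPoch_add_one (l : ℂ) (n : ℕ) (x : ℂ) :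
    (shiftPoch l (n + 1)).eval (x + 1) = (x - l) * (shiftPoch l n).eval x := by
  have h := eval_shiftPoch_mul l n 1 (x + 1)
  rw [← h, eval_shiftPoch_succ l 0, shiftPoch_zero]
  simp
  ring

/-- The polynomials `q i` of the realization of `Witt_>` with parameter `l`. -/
def raisePoly (l : ℂ) : ℤ → ℂ[X]
  | Int.ofNat n => (X + C (n * l)) * shiftPoch l n
  -- Only the index `-1` matters; below it the value is a default.
  | Int.negSucc _ => 1

theorem raisePoly_natCast (l : ℂ) (n : ℕ) :
    raisePoly l n = (X + C (n * l)) * shiftPoch l n := rfl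

theorem raisePoly_neg_one (l : ℂ) : raisePoly l (-1) = 1 := rfl

theorem raisePoly_zero (l : ℂ) : raisePoly l 0 = X := by
  simpa [shiftPoch_zero] using raisePoly_natCast l 0

theorem eval_raisePoly_one (l x : ℂ) : (raisePoly l 1).eval x = x ^ 2 - x - l * (l + 1) := by
  rw [← Nat.cast_one, raisePoly_natCast, eval_mul, eval_shiftPoch_succ, shiftPoch_zero]
  simp
  ring

theorem eval_raisePoly_two (l x : ℂ) : (raisePoly l 2).eval x =
    x ^ 3 - 3 * x ^ 2 + (2 - 3 * (l * (l + 1))) * x + 2 * (l * (l + 1)) * (l + 2) := by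
  rw [← Nat.cast_two, raisePoly_natCast, eval_mul, eval_shiftPoch_succ, eval_shiftPoch_succ,
    shiftPoch_zero]
  simp
  ring

theorem raisePoly_one_eq {l c : ℂ} (hl : l = c ∨ l = -c - 1) :
    raisePoly l 1 = X ^ 2 - X - C (c * (c + 1)) := by
  refine Polynomial.funext fun x => ?_
  rw [eval_raisePoly_one]
  rcases hl with rfl | rfl <;> simp
  ring

/-- For `i, j ≥ 0` both products contain the same factor `shiftPoch l (i + j)`, and what remains is
the order one identity for `x + il`. Brackets with index `-1` are checked separately, because there
the polynomial is not of this form. -/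
theorem wtBracket_raisePoly (l : ℂ) {i j : ℤ} (hi : -1 ≤ i) (hj : -1 ≤ j) :
    wtBracket i j (raisePoly l i) (raisePoly l j) = ((i : ℂ) - j) • raisePoly l (i + j) := by
  have hm : ∀ n : ℕ, wtBracket (-1) n (raisePoly l (-1)) (raisePoly l n) =
      (((-1 : ℤ) : ℂ) - (n : ℤ)) • raisePoly l (-1 + n) := by
    intro n
    refine Polynomial.funext fun x => ?_
    rw [eval_wtBracket, raisePoly_neg_one]
    rcases n with _ | n
    · simp [raisePoly_zero, raisePoly_neg_one]
    · rw [show (-1 + ((n + 1 : ℕ) : ℤ)) = (n : ℕ) by push_cast; ring, raisePoly_natCast,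
        raisePoly_natCast, show x - ((-1 : ℤ) : ℂ) = x + 1 by push_cast; ring, eval_mul, eval_mul,
        eval_shiftPoch_add_one, eval_shiftPoch_succ]
      simp
      ring
  obtain rfl | hi' := eq_or_lt_of_le hi
  · obtain rfl | hj' := eq_or_lt_of_le hj
    · simp [wtBracket]
    · lift j to ℕ using (by omega)
      exact hm j
  · lift i to ℕ using (by omega)
    obtain rfl | hj' := eq_or_lt_of_le hj
    · rw [wtBracket_swap, hm, ← neg_smul, neg_sub, add_comm]
    · lift j to ℕ using (by omega)
      refine Polynomial.funext fun x => ?_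
      have e1 := eval_shiftPoch_mul l i j x
      have e2 := eval_shiftPoch_mul l j i x
      rw [add_comm] at e2
      rw [eval_wtBracket, ← Nat.cast_add, raisePoly_natCast, raisePoly_natCast, raisePoly_natCast]
      simp only [eval_mul, eval_add, eval_X, eval_C, eval_smul, smul_eq_mul, Int.cast_natCast]
      push_cast
      linear_combination (x - j + i * l) * (x + j * l) * e1 -
        (x - i + j * l) * (x + i * l) * e2

/-- The relations of `Witt_>` leave two possibilities for `L 2`. -/
theorem eq_raisePoly_two {c : ℂ} {q : ℤ → ℂ[X]} (hm : q (-1) = 1)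
    (h1 : q 1 = X ^ 2 - X - C (c * (c + 1)))
    (h : ∀ i j : ℤ, -1 ≤ i → -1 ≤ j → i + j ≠ 0 →
      wtBracket i j (q i) (q j) = ((i : ℂ) - j) • q (i + j)) :
    q 2 = raisePoly c 2 ∨ q 2 = raisePoly (-c - 1) 2 := by
  set s := c * (c + 1) with hs
  have r := fun (i j : ℤ) hi hj hij (x : ℂ) => congrArg (eval x) (h i j hi hj hij)
  simp only [eval_wtBracket, eval_smul, smul_eq_mul] at r
  have e1 : ∀ x, (q 1).eval x = x ^ 2 - x - s := fun x => by simp [h1]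
  -- `[L (-1), L 2] = -3 L 1` prescribes the differences of `q 2`, leaving the constant `κ`.
  obtain ⟨κ, hκ⟩ := exists_eval_eq_add_of_sub_eq
    (p := q 2) (e := X ^ 3 - 3 * X ^ 2 + C (2 - 3 * s) * X) (by
      intro x
      have e := r (-1) 2 (by norm_num) (by norm_num) (by norm_num) (x - 1)
      norm_num [hm, e1] at e
      simp
      linear_combination -e)
  have e2 : ∀ x, (q 2).eval x = x ^ 3 - 3 * x ^ 2 + (2 - 3 * s) * x + κ := fun x => by
    rw [hκ]; simp
  have e3 : ∀ x, (q 3).eval x =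
      -((q 1).eval (x - 2) * (q 2).eval x - (q 2).eval (x - 1) * (q 1).eval x) := by
    intro x
    have e := r 1 2 (by norm_num) (by norm_num) (by norm_num) x
    norm_num at e
    linear_combination e
  have e4 : ∀ x, (q 4).eval x =
      -(1 / 2) * ((q 1).eval (x - 3) * (q 3).eval x - (q 3).eval (x - 1) * (q 1).eval x) := by
    intro x
    have e := r 1 3 (by norm_num) (by norm_num) (by norm_num) x
    norm_num at e
    linear_combination (1 / 2) * e
  -- `[L 1, L 4] = -3 L 5` and `[L 2, L 3] = -L 5`. Eliminating `q 5` at `x = 0` gives a quadratic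
  -- equation for `κ`.
  have e14 := r 1 4 (by norm_num) (by norm_num) (by norm_num) 0
  have e23 := r 2 3 (by norm_num) (by norm_num) (by norm_num) 0
  norm_num [e4, e3, e2, e1] at e14 e23
  have hquad : κ ^ 2 - 6 * s * κ + 4 * s ^ 2 * (2 - s) = 0 := by
    linear_combination (3 * e23 - e14) / 24
  -- The roots are the constant terms `2s(l+2)` of `raisePoly l 2` for `l = c` and `l = -c-1`.
  have hfac : (κ - 2 * s * (c + 2)) * (κ - 2 * s * (1 - c)) = 0 := by
    rw [hs] at hquad ⊢
    linear_combination hquad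
  rcases mul_eq_zero.mp hfac with hk | hk
  · left
    refine Polynomial.funext fun x => ?_
    rw [e2, eval_raisePoly_two]
    linear_combination hk
  · right
    refine Polynomial.funext fun x => ?_
    rw [e2, eval_raisePoly_two, hs]
    linear_combination hk

/-- `[L 1, L n] = (1 - n) L (n + 1)` has nonzero coefficient for `n ≥ 2`, so `L 1` and `L 2`
determine all higher terms. -/
theorem eq_raisePoly_of_eq_two {l : ℂ} {q : ℤ → ℂ[X]} (h1 : q 1 = raisePoly l 1)
    (h2 : q 2 = raisePoly l 2)
    (h : ∀ i j : ℤ, -1 ≤ i → -1 ≤ j → i + j ≠ 0 →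
      wtBracket i j (q i) (q j) = ((i : ℂ) - j) • q (i + j)) {n : ℕ} (hn : n ≠ 0) :
    q n = raisePoly l n := by
  obtain ⟨n, rfl⟩ := Nat.exists_eq_succ_of_ne_zero hn
  clear hn
  induction n with
  | zero => exact h1
  | succ n ih =>
    rcases n with _ | n
    · exact h2
    · have e1 := h 1 ((n + 2 : ℕ) : ℤ) (by norm_num) (by push_cast; omega) (by push_cast; omega)
      have e2 := wtBracket_raisePoly l (i := 1) (j := ((n + 2 : ℕ) : ℤ)) (by norm_num)
        (by push_cast; omega)
      rw [h1, ih, e2] at e1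
      have hne : ((1 : ℤ) : ℂ) - (((n + 2 : ℕ) : ℤ) : ℂ) ≠ 0 := by
        rw [← Int.cast_sub, Int.cast_ne_zero]
        push_cast
        omega
      have := smul_right_injective _ hne e1
      rw [show (((n + 1 + 1).succ : ℕ) : ℤ) = 1 + ((n + 2 : ℕ) : ℤ) by push_cast; ring]
      exact this.symm

theorem exists_eq_raisePoly {c : ℂ} {q : ℤ → ℂ[X]} (hm : q (-1) = 1)
    (h1 : q 1 = X ^ 2 - X - C (c * (c + 1)))
    (h : ∀ i j : ℤ, -1 ≤ i → -1 ≤ j → i + j ≠ 0 →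
      wtBracket i j (q i) (q j) = ((i : ℂ) - j) • q (i + j)) :
    ∃ l : ℂ, (l = c ∨ l = -c - 1) ∧ ∀ n : ℕ, n ≠ 0 → q n = raisePoly l n := by
  obtain ⟨l, hl, h2⟩ : ∃ l : ℂ, (l = c ∨ l = -c - 1) ∧ q 2 = raisePoly l 2 := by
    rcases eq_raisePoly_two hm h1 h with h2 | h2
    · exact ⟨c, Or.inl rfl, h2⟩
    · exact ⟨-c - 1, Or.inr rfl, h2⟩
  exact ⟨l, hl, fun n hn => eq_raisePoly_of_eq_two (by rw [h1, raisePoly_one_eq hl]) h2 h hn⟩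

theorem raisePoly_two_injective {c : ℂ} (hc : c ∈ CSl) (h0 : c ≠ 0) (h1 : c ≠ -1 / 2) :
    raisePoly c 2 ≠ raisePoly (-c - 1) 2 := by
  intro h
  have e := congrArg (eval 0) h
  rw [eval_raisePoly_two, eval_raisePoly_two] at e
  -- The constant terms differ by `2c(c+1)(2c+1)`; the root `c = -1` is outside `CSl`.
  have h2 : c * ((c + 1) * (2 * c + 1)) = 0 := by linear_combination e / 2
  rcases mul_eq_zero.mp h2 with h2 | h2
  · exact h0 h2
  · rcases mul_eq_zero.mp h2 with h2 | h2
    · have h3 : c = -1 := by linear_combination h2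
      rw [h3] at hc
      rcases hc with hc | ⟨hc, -⟩ <;> norm_num at hc
    · exact h1 (by linear_combination h2 / 2)

/-- For `c = -1/2` the two parameters are equal. For `c = 0` they are `0` and `-1`, but both
constant terms at index 2 vanish, and indices 1 and 2 determine the rest. -/
theorem raisePoly_eq_of_zero_or_half {c : ℂ} (hc : c = 0 ∨ c = -1 / 2) {n : ℕ} (hn : n ≠ 0) :
    raisePoly (-c - 1) n = raisePoly c n := by
  refine eq_raisePoly_of_eq_two ?_ ?_ (fun i j hi hj _ => wtBracket_raisePoly _ hi hj) hn
  · rw [raisePoly_one_eq (Or.inr rfl), raisePoly_one_eq (Or.inl rfl)]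
  · refine Polynomial.funext fun x => ?_
    rw [eval_raisePoly_two, eval_raisePoly_two]
    rcases hc with rfl | rfl <;> ring

end PolynomialIdentities

/-! ### Homomorphisms out of the Witt algebras -/

section Homs

variable {M : Type*} [LieRing M] [LieAlgebra ℂ M]

theorem Witt.lift_lie {s : Set ℤ} (hs : ∀ i ∈ s, ∀ j ∈ s, i ≠ j → i + j ∈ s) {v : ℤ → M}
    (hv : ∀ i ∈ s, ∀ j ∈ s, i + j ∈ s → ⁅v i, v j⁆ = ((i : ℂ) - j) • v (i + j)) {x y : Witt}
    (hx : x ∈ Witt.spanOn s) (hy : y ∈ Witt.spanOn s) :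
    Witt.lift v ⁅x, y⁆ = ⁅Witt.lift v x, Witt.lift v y⁆ := by
  induction hx using Submodule.span_induction with
  | zero => simp only [map_zero, zero_lie]
  | add a b _ _ ha hb => simp only [map_add, add_lie, ha, hb]
  | smul c a _ ha => simp only [map_smul, smul_lie, ha]
  | mem a ha =>
    obtain ⟨i, hi, rfl⟩ := ha
    induction hy using Submodule.span_induction with
    | zero => simp only [map_zero, lie_zero]
    | add a b _ _ ha hb => simp only [map_add, lie_add, ha, hb]
    | smul c a _ ha => simp only [map_smul, lie_smul, ha]
    | mem b hb =>
      obtain ⟨j, hj, rfl⟩ := hb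
      rw [Witt.lie_L, map_smul, Witt.lift_L, Witt.lift_L, Witt.lift_L]
      -- On the diagonal `2i` may leave `s`, but both sides are zero.
      by_cases hij : i = j
      · rw [hij, lie_self, sub_self, zero_smul]
      · exact (hv i hi j hj (hs i hi j hj hij)).symm

theorem Witt.mem_spanOn_univ (x : Witt) : x ∈ Witt.spanOn Set.univ := by
  induction x using Witt.induction_L with
  | zero => exact zero_mem _
  | add y z hy hz => exact add_mem hy hz
  | smul a y hy => exact Submodule.smul_mem _ a hy
  | basis i => exact Witt.L_mem_spanOn trivial

theorem Witt.exists_hom_subalgebraOn {s : Set ℤ} (hs : ∀ i ∈ s, ∀ j ∈ s, i ≠ j → i + j ∈ s)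
    {v : ℤ → M} (hv : ∀ i ∈ s, ∀ j ∈ s, i + j ∈ s → ⁅v i, v j⁆ = ((i : ℂ) - j) • v (i + j)) :
    ∃ f : Witt.subalgebraOn s hs →ₗ⁅ℂ⁆ M,
      ∀ i (hi : i ∈ s), f ⟨Witt.L i, Witt.L_mem_spanOn hi⟩ = v i :=
  ⟨{ toFun := fun x => Witt.lift v (x : Witt)
     map_add' := fun x y => map_add (Witt.lift v) (x : Witt) y
     map_smul' := fun a x => map_smul (Witt.lift v) a (x : Witt)
     map_lie' := fun {x y} => Witt.lift_lie hs hv x.2 y.2 },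
    fun i _ => Witt.lift_L v i⟩

/-- The projection of the Virasoro algebra to the Witt algebra. -/
def Vir.toWitt : Vir →ₗ⁅ℂ⁆ Witt where
  toFun x := x.1
  map_add' _ _ := rfl
  map_smul' _ _ := rfl
  map_lie' := rfl

/-- For `Vir` the homomorphism factors through the projection to `Witt`, so it kills `K`. -/
theorem WittKind.exists_hom (g : WittKind) {v : ℤ → M}
    (hv : ∀ i ∈ g.supp, ∀ j ∈ g.supp, i + j ∈ g.supp → ⁅v i, v j⁆ = ((i : ℂ) - j) • v (i + j)) :
    ∃ f : g.Alg →ₗ⁅ℂ⁆ M, ∀ i (hi : i ∈ g.supp), f (g.L i hi) = v i := by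
  have hfull : (∀ i j : ℤ, ⁅v i, v j⁆ = ((i : ℂ) - j) • v (i + j)) →
      ∃ f : Witt →ₗ⁅ℂ⁆ M, ∀ i, f (Witt.L i) = v i := fun hv =>
    ⟨{ Witt.lift v with
        map_lie' := fun {x y} => Witt.lift_lie (s := Set.univ) (fun _ _ _ _ _ => trivial)
          (fun i _ j _ _ => hv i j) (Witt.mem_spanOn_univ x) (Witt.mem_spanOn_univ y) },
      fun i => Witt.lift_L v i⟩
  cases g with
  | pos => exact Witt.exists_hom_subalgebraOn _ hv
  | neg => exact Witt.exists_hom_subalgebraOn _ hv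
  | full =>
    obtain ⟨f, hf⟩ := hfull fun i j => hv i trivial j trivial trivial
    exact ⟨f, fun i _ => hf i⟩
  | vir =>
    obtain ⟨f, hf⟩ := hfull fun i j => hv i trivial j trivial trivial
    exact ⟨f.comp Vir.toWitt, fun i _ => hf i⟩

theorem Witt.subalgebraOn_hom_ext {s : Set ℤ} {hs : ∀ i ∈ s, ∀ j ∈ s, i ≠ j → i + j ∈ s}
    {f f' : Witt.subalgebraOn s hs →ₗ⁅ℂ⁆ M}
    (h : ∀ i (hi : i ∈ s), f ⟨Witt.L i, Witt.L_mem_spanOn hi⟩ =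
      f' ⟨Witt.L i, Witt.L_mem_spanOn hi⟩) : f = f' := by
  ext ⟨x, hx⟩
  replace hx : x ∈ Witt.spanOn s := hx
  induction hx using Submodule.span_induction with
  | zero => exact (map_zero f).trans (map_zero f').symm
  | add a b ha hb h1 h2 =>
    exact (map_add f (⟨a, ha⟩ : Witt.subalgebraOn s hs) ⟨b, hb⟩).trans
      ((congrArg₂ _ (h1 ha) (h2 hb)).trans (map_add f' (⟨a, ha⟩ : Witt.subalgebraOn s hs) ⟨b, hb⟩).symm)
  | smul c a ha h1 =>
    exact (map_smul f c (⟨a, ha⟩ : Witt.subalgebraOn s hs)).trans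
      ((congrArg _ (h1 ha)).trans (map_smul f' c (⟨a, ha⟩ : Witt.subalgebraOn s hs)).symm)
  | mem a ha =>
    obtain ⟨i, hi, rfl⟩ := ha
    exact h i hi

theorem Sl2.hom_ext {f f' : Sl2 →ₗ⁅ℂ⁆ M} (h : ∀ i hi, f (Sl2.L i hi) = f' (Sl2.L i hi)) :
    f = f' :=
  Witt.subalgebraOn_hom_ext h

theorem WittKind.hom_ext (g : WittKind) {f f' : g.Alg →ₗ⁅ℂ⁆ M}
    (h : ∀ i hi, f (g.L i hi) = f' (g.L i hi))
    (hK : ∀ hg : g = WittKind.vir, f (hg ▸ Vir.K : g.Alg) = f' (hg ▸ Vir.K : g.Alg)) : f = f' := by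
  cases g with
  | pos => exact Witt.subalgebraOn_hom_ext h
  | neg => exact Witt.subalgebraOn_hom_ext h
  | full =>
    ext x
    change Witt at x
    induction x using Witt.induction_L with
    | zero => exact (map_zero f).trans (map_zero f').symm
    | add y z hy hz => exact (map_add f y z).trans ((congrArg₂ _ hy hz).trans (map_add f' y z).symm)
    | smul a y hy => exact (map_smul f a y).trans ((congrArg _ hy).trans (map_smul f' a y).symm)
    | basis i => exact h i trivial
  | vir =>
    have hL : ∀ x : Witt, f ((x, 0) : Witt × ℂ) = f' ((x, 0) : Witt × ℂ) := by
      intro x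
      induction x using Witt.induction_L with
      | zero => exact (map_zero f).trans (map_zero f').symm
      | add y z hy hz =>
        have e : ((y + z, 0) : Witt × ℂ) = (y, 0) + (z, 0) := by simp
        rw [e]
        exact (map_add f ((y, 0) : Witt × ℂ) ((z, 0) : Witt × ℂ)).trans
          ((congrArg₂ _ hy hz).trans
            (map_add f' ((y, 0) : Witt × ℂ) ((z, 0) : Witt × ℂ)).symm)
      | smul a y hy =>
        have e : ((a • y, 0) : Witt × ℂ) = a • (y, 0) := by simp
        rw [e]
        exact (map_smul f a ((y, 0) : Witt × ℂ)).trans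
          ((congrArg _ hy).trans (map_smul f' a ((y, 0) : Witt × ℂ)).symm)
      | basis i => exact h i trivial
    ext x
    obtain ⟨x, a⟩ := x
    have e : ((x, a) : Witt × ℂ) = (x, 0) + a • ((0, 1) : Witt × ℂ) := by simp
    have e2 : ∀ f : WittKind.vir.Alg →ₗ⁅ℂ⁆ M, f ((x, a) : Witt × ℂ) =
        f ((x, 0) : Witt × ℂ) + a • f ((0, 1) : Witt × ℂ) := by
      intro f
      rw [e]
      exact (map_add f ((x, 0) : Witt × ℂ) (a • ((0, 1) : Witt × ℂ))).trans
        (congrArg _ (map_smul f a ((0, 1) : Witt × ℂ)))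
    exact (e2 f).trans ((congrArg₂ _ (hL x) (congrArg _ (hK rfl))).trans (e2 f').symm)

/-- The last hypothesis describes where the cocycle vanishes, so that `Vir` can be treated like the
other three algebras. -/
theorem WittKind.lie_L (g : WittKind) {i j : ℤ} (hi : i ∈ g.supp) (hj : j ∈ g.supp)
    (hij : i + j ∈ g.supp) (h : i + j ≠ 0 ∨ i = -1 ∨ i = 0 ∨ i = 1) :
    ⁅g.L i hi, g.L j hj⁆ = ((i : ℂ) - j) • g.L (i + j) hij := by
  cases g with
  | pos => exact Subtype.ext (Witt.lie_L i j)
  | neg => exact Subtype.ext (Witt.lie_L i j)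
  | full => exact Witt.lie_L i j
  | vir =>
    refine Prod.ext (Witt.lie_L i j) ?_
    change Vir.cocycle (Witt.L i) (Witt.L j) = ((i : ℂ) - j) * 0
    rw [Vir.cocycle_L, mul_zero]
    split_ifs with h0
    · rcases h with h | rfl | rfl | rfl
      · exact absurd h0 h
      all_goals norm_num
    · rfl

theorem Vir.lie_two_neg_two : ⁅Vir.L 2, Vir.L (-2)⁆ = (4 : ℂ) • Vir.L 0 + (1 / 2 : ℂ) • Vir.K := by
  refine Prod.ext ?_ ?_
  · change ⁅Witt.L 2, Witt.L (-2)⁆ = (4 : ℂ) • Witt.L 0 + (1 / 2 : ℂ) • (0 : Witt)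
    rw [Witt.lie_L, smul_zero, add_zero]
    norm_num
  · change Vir.cocycle (Witt.L 2) (Witt.L (-2)) = (4 : ℂ) * 0 + (1 / 2) * 1
    rw [Vir.cocycle_L]
    norm_num

theorem Sl2.lie_L {i j : ℤ} (hi : -1 ≤ i ∧ i ≤ 1) (hj : -1 ≤ j ∧ j ≤ 1)
    (hij : -1 ≤ i + j ∧ i + j ≤ 1) :
    ⁅Sl2.L i hi, Sl2.L j hj⁆ = ((i : ℂ) - j) • Sl2.L (i + j) hij :=
  Subtype.ext (Witt.lie_L i j)

/-- The Chevalley involution of `sl(2)`. -/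
def chevalleySl2 : Sl2 →ₗ⁅ℂ⁆ Sl2 where
  toFun x := ⟨Witt.chevalley x, Witt.chevalley_mem
    (fun i (hi : -1 ≤ i ∧ i ≤ 1) => show -1 ≤ -i ∧ -i ≤ 1 by omega) x.2⟩
  map_add' x y := Subtype.ext (map_add Witt.chevalley (x : Witt) y)
  map_smul' a x := Subtype.ext (map_smul Witt.chevalley a (x : Witt))
  map_lie' {x y} := Subtype.ext (LieHom.map_lie Witt.chevalley (x : Witt) y)

theorem chevalleySl2_L {i : ℤ} (hi : -1 ≤ i ∧ i ≤ 1) :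
    chevalleySl2 (Sl2.L i hi) = (-1 : ℂ) ^ (i + 1) • Sl2.L (-i) (by omega) :=
  Subtype.ext (Witt.chevalleyMap_L i)

theorem chevalleyPosNeg_L {i : ℤ} (hi : i ∈ WittKind.pos.supp) :
    chevalleyPosNeg (WittKind.pos.L i hi) =
      (-1 : ℂ) ^ (i + 1) • WittKind.neg.L (-i) (show -i ≤ 1 from neg_le.mp hi) :=
  Subtype.ext (Witt.chevalleyMap_L i)

theorem Witt.chevalley_chevalley (x : Witt) : Witt.chevalley (Witt.chevalley x) = x := by
  change Witt.chevalleyMap (Witt.chevalleyMap x) = x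
  induction x using Witt.induction_L with
  | zero => simp only [map_zero]
  | add y z hy hz => simp only [map_add, hy, hz]
  | smul a y hy => simp only [map_smul, hy]
  | basis i =>
    rw [Witt.chevalleyMap_L, map_smul, Witt.chevalleyMap_L, smul_smul, neg_neg,
      ← zpow_add₀ (by norm_num), show i + 1 + (-i + 1) = 2 by ring]
    norm_num

theorem chevalleySl2_comp_self (f : Sl2 →ₗ⁅ℂ⁆ M) : (f.comp chevalleySl2).comp chevalleySl2 = f := by
  ext x
  exact congrArg f (Subtype.ext (Witt.chevalley_chevalley (x : Witt)))

theorem comp_chevalleyPosNeg_comp (f : WittKind.pos.Alg →ₗ⁅ℂ⁆ M) :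
    (f.comp chevalleyNegPos).comp chevalleyPosNeg = f := by
  ext x
  exact congrArg f (Subtype.ext (Witt.chevalley_chevalley (show WittPos from x).1))

theorem comp_chevalleyNegPos_comp (f : WittKind.neg.Alg →ₗ⁅ℂ⁆ M) :
    (f.comp chevalleyPosNeg).comp chevalleyNegPos = f := by
  ext x
  exact congrArg f (Subtype.ext (Witt.chevalley_chevalley (show WittNeg from x).1))

end Homs

/-! ### Realizations of `sl(2)` -/

section Sl2Realizations

open Polynomial

variable {V : Type*} [Field V] [Algebra ℂ V] {D : Derivation ℂ V V}

theorem Diff.coe_lie (P Q : Diff D) :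
    ((⁅P, Q⁆ : Diff D) : Module.End ℂ V) = (P : Module.End ℂ V) * Q - Q * P := rfl

theorem HasOrder.unique (hD : ∃ z : V, D z ≠ 0) {P : Module.End ℂ V} {k l : ℕ}
    (hk : HasOrder D P k) (hl : HasOrder D P l) : k = l := by
  obtain ⟨F, hF, rfl⟩ := hasOrder_iff.mp hk
  obtain ⟨G, hG, h⟩ := hasOrder_iff.mp hl
  rw [leftEval_der_injective hD h, hF] at hG
  exact_mod_cast hG

theorem HasOrder.neg {P : Module.End ℂ V} {k : ℕ} (h : HasOrder D P k) : HasOrder D (-P) k := by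
  obtain ⟨F, hF, rfl⟩ := hasOrder_iff.mp h
  exact hasOrder_iff.mpr ⟨-F, by rw [degree_neg, hF], map_neg _ _⟩

theorem opOne_eq_wt {t : Triple V} (ht : D t.h ≠ 0) (i : ℤ) :
    opOne D t i = wt D t i (X + C (i * t.c)) := by
  have h0 := Triple.h_ne_zero ht
  rw [wt_apply, map_add, aeval_X, aeval_C, opOne, opZero, zpow_add_one₀ h0]
  ext f
  change -(t.h ^ i * t.h / D t.h) * D f + (t.b + i * algebraMap ℂ V t.c) * t.h ^ i * f =
    t.h ^ i * (-(t.h / D t.h) * D f + t.b * f + ((i : ℂ) * t.c) • f)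
  rw [Algebra.smul_def, map_mul, map_intCast]
  ring

theorem isTripleZero_iff {σ : Sl2 →ₗ⁅ℂ⁆ Diff D} {t : Triple V} : IsTripleZero D σ t ↔
    (σ (Sl2.L (-1) (by norm_num)) : Module.End ℂ V) = wt D t (-1) 1 ∧
    (σ (Sl2.L 0 (by norm_num)) : Module.End ℂ V) = wt D t 0 X ∧
    (σ (Sl2.L 1 (by norm_num)) : Module.End ℂ V) =
      wt D t 1 (X ^ 2 - X - C (t.c * (t.c + 1))) := by
  simp only [IsTripleZero, wt_apply, map_one, map_sub, map_pow, aeval_X, aeval_C, zpow_neg_one,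
    zpow_zero, zpow_one, one_smul, scal, smul_sub]

theorem isTripleTwo_iff {σ : Sl2 →ₗ⁅ℂ⁆ Diff D} {t : Triple V} : IsTripleTwo D σ t ↔
    (σ (Sl2.L (-1) (by norm_num)) : Module.End ℂ V) =
      wt D t (-1) (X ^ 2 + X - C (t.c * (t.c + 1))) ∧
    (σ (Sl2.L 0 (by norm_num)) : Module.End ℂ V) = wt D t 0 X ∧
    (σ (Sl2.L 1 (by norm_num)) : Module.End ℂ V) = wt D t 1 1 := by
  simp only [IsTripleTwo, wt_apply, map_one, map_sub, map_add, map_pow, aeval_X, aeval_C,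
    zpow_neg_one, zpow_zero, zpow_one, one_smul, scal, smul_sub, smul_add]

theorem isTripleOne_iff {σ : Sl2 →ₗ⁅ℂ⁆ Diff D} {t : Triple V} (ht : D t.h ≠ 0) :
    IsTripleOne D σ t ↔
    (σ (Sl2.L (-1) (by norm_num)) : Module.End ℂ V) = wt D t (-1) (X - C t.c) ∧
    (σ (Sl2.L 0 (by norm_num)) : Module.End ℂ V) = wt D t 0 X ∧
    (σ (Sl2.L 1 (by norm_num)) : Module.End ℂ V) = wt D t 1 (X + C t.c) := by
  have e : ∀ i : ℤ, wt D t i (X + C (i * t.c)) = opOne D t i := fun i => (opOne_eq_wt ht i).symm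
  have em := e (-1)
  have e0 := e 0
  have e1 := e 1
  simp only [Int.cast_neg, Int.cast_one, neg_mul, one_mul, map_neg, ← sub_eq_add_neg] at em
  simp only [Int.cast_zero, zero_mul, map_zero, add_zero] at e0
  simp only [Int.cast_one, one_mul] at e1
  rw [em, e0, e1]
  constructor
  · intro h
    exact ⟨h _ _, h _ _, h _ _⟩
  · rintro ⟨hm, h0, h1⟩ i hi
    obtain rfl | rfl | rfl : i = -1 ∨ i = 0 ∨ i = 1 := by omega
    exacts [hm, h0, h1]

/-- An `sl(2)` triple in which `L 0` has order one is made of homogeneous operators. -/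
theorem exists_wt_of_mem_slRealizations (hV : IsRationalFunctions D ∨ IsLaurentSeries D)
    {σ : Sl2 →ₗ⁅ℂ⁆ Diff D} (hσ : σ ∈ SlRealizations D) :
    ∃ (t : Triple V) (p m : ℂ[X]), D t.h ≠ 0 ∧
      (σ (Sl2.L (-1) (by norm_num)) : Module.End ℂ V) = wt D t (-1) m ∧
      (σ (Sl2.L 0 (by norm_num)) : Module.End ℂ V) = wt D t 0 X ∧
      (σ (Sl2.L 1 (by norm_num)) : Module.End ℂ V) = wt D t 1 p ∧
      wtBracket 1 (-1) p m = (2 : ℂ) • X := by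
  obtain ⟨a, b, ha, hA⟩ := hasOrder_one_iff.mp hσ
  have hD := exists_der_ne_zero hV
  have hbr : ∀ (i j : ℤ) (hi hj hij), (σ (Sl2.L i hi) : Module.End ℂ V) * σ (Sl2.L j hj) -
      σ (Sl2.L j hj) * σ (Sl2.L i hi) = ((i : ℂ) - j) • (σ (Sl2.L (i + j) hij) : Module.End ℂ V) :=
    fun i j hi hj hij => by
      rw [← Diff.coe_lie, ← LieHom.map_lie, Sl2.lie_L hi hj hij, map_smul]; rfl
  have h0m := hbr 0 (-1) (by norm_num) (by norm_num) (by norm_num)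
  have h01 := hbr 0 1 (by norm_num) (by norm_num) (by norm_num)
  have h1m := hbr 1 (-1) (by norm_num) (by norm_num) (by norm_num)
  simp only [zero_add, add_neg_cancel] at h0m h01 h1m
  obtain ⟨F, hF⟩ := (mem_Diff_iff_leftEval (b := b) ha).mp (σ (Sl2.L (-1) (by norm_num))).2
  -- If `L (-1)` acted as zero, so would `[L 1, L (-1)] = 2 L 0`.
  have hF0 : F ≠ 0 := by
    rintro rfl
    rw [map_zero] at hF
    rw [← hF, mul_zero, zero_mul, sub_zero, hA] at h1m
    have h2 : leftEval (a • der D + b • 1) (X : V[X]) = 0 := by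
      rw [← monomial_one_one_eq_X, leftEval_monomial, one_smul, pow_one]
      exact (smul_eq_zero.mp h1m.symm).resolve_left (by norm_num)
    rw [← map_zero (leftEval (a • der D + b • 1))] at h2
    exact X_ne_zero (leftEval_injective hD ha h2)
  obtain ⟨j, hj⟩ : ∃ j, F.coeff j ≠ 0 := by
    by_contra! h
    exact hF0 (Polynomial.ext fun j => by rw [h j, coeff_zero])
  set f := F.coeff j with hf
  have hDf : a * D f = f := by
    have h := coeff_of_commutator_eq_smul (μ := 1) (b := b) (F := F) hD ha (by
      rw [hF, ← hA, h0m]; norm_num) j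
    rwa [map_one, one_mul] at h
  have hDf0 : D f ≠ 0 := by intro h; rw [h, mul_zero] at hDf; exact hj hDf.symm
  let t : Triple V := ⟨f⁻¹, b, 0⟩
  have hth : D t.h = -(f⁻¹ ^ 2 * D f) := by
    change D f⁻¹ = _
    rw [Derivation.leibniz_inv, smul_eq_mul, neg_mul]
  have ht : D t.h ≠ 0 := by
    rw [hth]
    exact neg_ne_zero.mpr (mul_ne_zero (pow_ne_zero 2 (inv_ne_zero hj)) hDf0)
  have hA' : (σ (Sl2.L 0 (by norm_num)) : Module.End ℂ V) = opZero D t := by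
    rw [hA, opZero, hth]
    change _ = (-(f⁻¹ / _)) • der D + b • 1
    congr 2
    field_simp
    exact hDf
  rw [hA'] at h0m h01
  obtain ⟨m, hm⟩ := exists_eq_wt hV ht (i := -1) (σ (Sl2.L (-1) (by norm_num))).2 (by
    rw [h0m]; norm_num)
  obtain ⟨p, hp⟩ := exists_eq_wt hV ht (i := 1) (σ (Sl2.L 1 (by norm_num))).2 (by
    rw [h01]; norm_num)
  refine ⟨t, p, m, ht, hm, by rw [wt_zero_X, hA'], hp, wt_injective ht 0 ?_⟩
  rw [hm, hp, wt_commutator ht, hA', ← wt_zero_X, ← map_smul] at h1m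
  rw [add_neg_cancel] at h1m
  rw [h1m]
  norm_num

/-- Orders are degrees of weight polynomials, and these add up to 2; the zero polynomial is excluded
because the bracket must be `2x`. -/
theorem slRealizations_subset (hV : IsRationalFunctions D ∨ IsLaurentSeries D)
    {σ : Sl2 →ₗ⁅ℂ⁆ Diff D} (hσ : σ ∈ SlRealizations D) :
    ∃ k l : ℕ, k + l = 2 ∧ HasOrder D (σ (Sl2.L (-1) (by norm_num))) k ∧
      HasOrder D (σ (Sl2.L 1 (by norm_num))) l := by
  obtain ⟨t, p, m, ht, hm, -, hp, h⟩ := exists_wt_of_mem_slRealizations hV hσ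
  have hdeg := natDegree_add_natDegree_eq_two h
  have hne : ∀ q : ℂ[X], q ≠ 0 → q.degree = q.natDegree := fun q hq => degree_eq_natDegree hq
  refine ⟨m.natDegree, p.natDegree, by omega, ?_, ?_⟩
  · rw [hm, hasOrder_wt_iff ht]
    refine hne m ?_
    rintro rfl
    simpa [wtBracket] using congrArg (eval 1) h
  · rw [hp, hasOrder_wt_iff ht]
    refine hne p ?_
    rintro rfl
    simpa [wtBracket] using congrArg (eval 1) h

/-! ### Existence and uniqueness of triples in orders zero and one. -/

theorem exists_isTripleZero (hV : IsRationalFunctions D ∨ IsLaurentSeries D)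
    {σ : Sl2 →ₗ⁅ℂ⁆ Diff D} (hσ : σ ∈ SlRealizationsOf D 0) :
    ∃ t ∈ TriplesZero D, IsTripleZero D σ t := by
  obtain ⟨t, p, m, ht, hm, h0, hp, h⟩ := exists_wt_of_mem_slRealizations hV hσ.1
  have hk := hσ.2
  rw [hm, hasOrder_wt_iff ht] at hk
  obtain ⟨ν, c, hν, hc, rfl, rfl⟩ := normal_form_zero h hk
  rw [← wt_rescale hν] at hm hp
  -- The scalar `ν` is absorbed into `h`, and `c` may be inserted freely since `wt` ignores it.
  refine ⟨⟨(t.rescale ν).h, t.b, c⟩, ⟨der_rescale_ne_zero ht hν, hc⟩,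
    isTripleZero_iff.mpr ⟨hm, ?_, hp⟩⟩
  rw [h0]
  exact (by rw [wt_rescale hν, zpow_zero, one_smul] : wt D t 0 X = wt D (t.rescale ν) 0 X)

theorem exists_isTripleOne (hV : IsRationalFunctions D ∨ IsLaurentSeries D)
    {σ : Sl2 →ₗ⁅ℂ⁆ Diff D} (hσ : σ ∈ SlRealizationsOf D 1) :
    ∃ t ∈ TriplesOne D, IsTripleOne D σ t := by
  obtain ⟨t, p, m, ht, hm, h0, hp, h⟩ := exists_wt_of_mem_slRealizations hV hσ.1
  have hk := hσ.2
  rw [hm, hasOrder_wt_iff ht] at hk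
  obtain ⟨ν, c, hν, rfl, rfl⟩ := normal_form_one h hk
  rw [← wt_rescale hν] at hm hp
  have ht' : D (⟨(t.rescale ν).h, t.b, c⟩ : Triple V).h ≠ 0 := der_rescale_ne_zero ht hν
  refine ⟨⟨(t.rescale ν).h, t.b, c⟩, ht', (isTripleOne_iff ht').mpr ⟨hm, ?_, hp⟩⟩
  rw [h0]
  exact (by rw [wt_rescale hν, zpow_zero, one_smul] : wt D t 0 X = wt D (t.rescale ν) 0 X)

theorem smul_one_apply (f g : V) : (f • (1 : Module.End ℂ V)) g = f * g := rfl

theorem opZero_apply (t : Triple V) (f : V) :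
    opZero D t f = -(t.h / D t.h) * D f + t.b * f := rfl

theorem opOne_apply (t : Triple V) (i : ℤ) (f : V) : opOne D t i f =
    -(t.h ^ (i + 1) / D t.h) * D f + (t.b + i * algebraMap ℂ V t.c) * t.h ^ i * f := rfl

theorem Triple.ext' {V : Type*} {t t' : Triple V} (hh : t.h = t'.h) (hb : t.b = t'.b) (hc : t.c = t'.c) :
    t = t' := by
  cases t; cases t'; simp_all

/-- Applied to the function 1, `L (-1)` and `L 0` return `h⁻¹` and `b`. `L 1` then determines
`c(c+1)`, and `CSl` removes the ambiguity `c ↦ -c-1`. -/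
theorem IsTripleZero.unique {σ : Sl2 →ₗ⁅ℂ⁆ Diff D} {t t' : Triple V} (ht : t ∈ TriplesZero D)
    (ht' : t' ∈ TriplesZero D) (h : IsTripleZero D σ t) (h' : IsTripleZero D σ t') : t = t' := by
  have hh : t.h = t'.h := by
    have e := congrArg (fun P : Module.End ℂ V => P 1) (h.1.symm.trans h'.1)
    simp only [smul_one_apply, mul_one] at e
    exact inv_injective e
  have hb : t.b = t'.b := by
    have e := congrArg (fun P : Module.End ℂ V => P 1) (h.2.1.symm.trans h'.2.1)
    simpa [opZero_apply] using e
  have e := (isTripleZero_iff.mp h).2.2.symm.trans (isTripleZero_iff.mp h').2.2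
  have hw : wt D t' = wt D t := by
    refine funext fun i => LinearMap.ext fun q => ?_
    rw [wt_apply, wt_apply, opZero, opZero, hh, hb]
  rw [hw] at e
  have e2 := congrArg (eval 0) (wt_injective ht.1 1 e)
  exact Triple.ext' hh hb (CSl.eq_of_mul_add_one_eq ht.2 ht'.2 (by simpa using e2))

/-- Testing on 1 and on `h` separates symbols from scalar parts: `L (-1)` gives `h'`, `L 0` gives
`b` and `h/h'`, and the scalar part of `L (-1)` then gives `c`. -/
theorem IsTripleOne.unique {σ : Sl2 →ₗ⁅ℂ⁆ Diff D} {t t' : Triple V} (ht : t ∈ TriplesOne D)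
    (ht' : t' ∈ TriplesOne D) (h : IsTripleOne D σ t) (h' : IsTripleOne D σ t') : t = t' := by
  have e : ∀ (i : ℤ) (hi : -1 ≤ i ∧ i ≤ 1) (f : V), opOne D t i f = opOne D t' i f :=
    fun i hi f => congrArg (fun P : Module.End ℂ V => P f) ((h i hi).symm.trans (h' i hi))
  replace ht : D t.h ≠ 0 := ht
  replace ht' : D t'.h ≠ 0 := ht'
  have h0 := Triple.h_ne_zero ht
  have hb : t.b = t'.b := by simpa [opOne_apply] using e 0 (by norm_num) 1
  have em1 := e (-1) (by norm_num) 1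
  have em := e (-1) (by norm_num) t.h
  have e0 := e 0 (by norm_num) t.h
  simp only [opOne_apply, Derivation.map_one_eq_zero, mul_zero, zero_add, mul_one,
    zpow_one, zpow_zero, neg_add_cancel, hb, Int.cast_zero, zero_mul, add_zero,
    add_left_inj] at em1 em e0
  rw [em1] at em
  have hd : D t.h = D t'.h := by
    have := neg_injective (mul_right_cancel₀ ht (add_right_cancel em))
    simpa using this
  have hh : t.h = t'.h := by
    have := neg_injective (mul_right_cancel₀ ht e0)
    rwa [hd, div_left_inj' ht'] at this
  have hc : t.c = t'.c := by
    rw [hh] at em1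
    have h3 := mul_right_cancel₀ (zpow_ne_zero (-1) (Triple.h_ne_zero ht')) em1
    simpa using h3
  exact Triple.ext' hh hb hc

theorem IsTripleZero.mem {σ : Sl2 →ₗ⁅ℂ⁆ Diff D} {t : Triple V} (ht : D t.h ≠ 0)
    (h : IsTripleZero D σ t) : σ ∈ SlRealizationsOf D 0 := by
  obtain ⟨h1, h2, -⟩ := isTripleZero_iff.mp h
  refine ⟨?_, ?_⟩
  · change HasOrder D _ 1
    rw [h2, hasOrder_wt_iff ht]
    simp
  · rw [h1, hasOrder_wt_iff ht]
    simp

theorem IsTripleOne.mem {σ : Sl2 →ₗ⁅ℂ⁆ Diff D} {t : Triple V} (ht : D t.h ≠ 0)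
    (h : IsTripleOne D σ t) : σ ∈ SlRealizationsOf D 1 := by
  obtain ⟨h1, h2, -⟩ := (isTripleOne_iff ht).mp h
  refine ⟨?_, ?_⟩
  · change HasOrder D _ 1
    rw [h2, hasOrder_wt_iff ht]
    simp
  · rw [h1, hasOrder_wt_iff ht, degree_X_sub_C]
    rfl

theorem Sl2.hom_ext_coe {σ σ' : Sl2 →ₗ⁅ℂ⁆ Diff D}
    (hm : (σ (Sl2.L (-1) (by norm_num)) : Module.End ℂ V) = σ' (Sl2.L (-1) (by norm_num)))
    (h0 : (σ (Sl2.L 0 (by norm_num)) : Module.End ℂ V) = σ' (Sl2.L 0 (by norm_num)))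
    (h1 : (σ (Sl2.L 1 (by norm_num)) : Module.End ℂ V) = σ' (Sl2.L 1 (by norm_num))) : σ = σ' := by
  refine Sl2.hom_ext fun i hi => Subtype.ext ?_
  obtain rfl | rfl | rfl : i = -1 ∨ i = 0 ∨ i = 1 := by omega
  exacts [hm, h0, h1]

theorem IsTripleZero.hom_unique {σ σ' : Sl2 →ₗ⁅ℂ⁆ Diff D} {t : Triple V}
    (h : IsTripleZero D σ t) (h' : IsTripleZero D σ' t) : σ = σ' :=
  Sl2.hom_ext_coe (h.1.trans h'.1.symm) (h.2.1.trans h'.2.1.symm) (h.2.2.trans h'.2.2.symm)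

theorem IsTripleOne.hom_unique {σ σ' : Sl2 →ₗ⁅ℂ⁆ Diff D} {t : Triple V}
    (h : IsTripleOne D σ t) (h' : IsTripleOne D σ' t) : σ = σ' :=
  Sl2.hom_ext fun i hi => Subtype.ext ((h i hi).trans (h' i hi).symm)

end Sl2Realizations

/-! ### The Chevalley involution on realizations of `sl(2)` -/

section Realizations

open Polynomial

variable {V : Type*} [Field V] [Algebra ℂ V] {D : Derivation ℂ V V}

theorem coe_comp_chevalleySl2 (σ : Sl2 →ₗ⁅ℂ⁆ Diff D) {i : ℤ} (hi : -1 ≤ i ∧ i ≤ 1) :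
    ((σ.comp chevalleySl2) (Sl2.L i hi) : Module.End ℂ V) =
      (-1 : ℂ) ^ (i + 1) • (σ (Sl2.L (-i) (by omega)) : Module.End ℂ V) := by
  rw [LieHom.comp_apply, chevalleySl2_L, map_smul]
  rfl

theorem coe_comp_chevalleySl2_neg_one (σ : Sl2 →ₗ⁅ℂ⁆ Diff D) :
    ((σ.comp chevalleySl2) (Sl2.L (-1) (by norm_num)) : Module.End ℂ V) =
      σ (Sl2.L 1 (by norm_num)) := by
  rw [coe_comp_chevalleySl2]
  simp

theorem coe_comp_chevalleySl2_zero (σ : Sl2 →ₗ⁅ℂ⁆ Diff D) :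
    ((σ.comp chevalleySl2) (Sl2.L 0 (by norm_num)) : Module.End ℂ V) =
      -σ (Sl2.L 0 (by norm_num)) := by
  rw [coe_comp_chevalleySl2]
  ext f
  simp

theorem coe_comp_chevalleySl2_one (σ : Sl2 →ₗ⁅ℂ⁆ Diff D) :
    ((σ.comp chevalleySl2) (Sl2.L 1 (by norm_num)) : Module.End ℂ V) =
      σ (Sl2.L (-1) (by norm_num)) := by
  rw [coe_comp_chevalleySl2]
  norm_num

theorem comp_chevalleySl2_mem (hV : IsRationalFunctions D ∨ IsLaurentSeries D)
    {σ : Sl2 →ₗ⁅ℂ⁆ Diff D} {k l : ℕ} (hkl : k + l = 2) (hσ : σ ∈ SlRealizationsOf D k) :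
    σ.comp chevalleySl2 ∈ SlRealizationsOf D l := by
  obtain ⟨k', l', hkl', hk', hl'⟩ := slRealizations_subset hV hσ.1
  have := hσ.2.unique (exists_der_ne_zero hV) hk'
  obtain rfl : l' = l := by omega
  refine ⟨?_, ?_⟩
  · change HasOrder D _ 1
    rw [coe_comp_chevalleySl2_zero]
    exact HasOrder.neg hσ.1
  · rw [coe_comp_chevalleySl2_neg_one]
    exact hl'

/-- The involution swaps `L 1` with `L (-1)` and negates `L 0`; under `A ↦ -A` the polynomial `A² +
A` becomes `A² - A`. This transfers order zero results to order two. -/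
theorem isTripleTwo_iff_dual {σ : Sl2 →ₗ⁅ℂ⁆ Diff D} {t : Triple V} (ht : D t.h ≠ 0) :
    IsTripleTwo D σ t ↔ IsTripleZero D (σ.comp chevalleySl2) t.dual := by
  have e : (-opZero D t) ^ 2 - -opZero D t = opZero D t ^ 2 + opZero D t :=
    (sub_neg_eq_add _ _).trans (congrArg (· + _) (neg_sq (opZero D t)))
  rw [IsTripleZero, coe_comp_chevalleySl2_neg_one, coe_comp_chevalleySl2_zero,
    coe_comp_chevalleySl2_one, opZero_dual ht, neg_inj, e]
  simp only [Triple.dual, inv_inv]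
  exact ⟨fun h => ⟨h.2.2, h.2.1, h.1⟩, fun h => ⟨h.2.2, h.2.1, h.1⟩⟩

theorem dual_mem_triplesZero {t : Triple V} (ht : t ∈ TriplesZero D) :
    t.dual ∈ TriplesZero D :=
  ⟨der_dual_ne_zero ht.1, ht.2⟩

theorem exists_isTripleTwo (hV : IsRationalFunctions D ∨ IsLaurentSeries D)
    {σ : Sl2 →ₗ⁅ℂ⁆ Diff D} (hσ : σ ∈ SlRealizationsOf D 2) :
    ∃ t ∈ TriplesZero D, IsTripleTwo D σ t := by
  obtain ⟨t, ht, h⟩ := exists_isTripleZero hV (comp_chevalleySl2_mem hV (l := 0) rfl hσ)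
  exact ⟨t.dual, dual_mem_triplesZero ht, (isTripleTwo_iff_dual (der_dual_ne_zero ht.1)).mpr
    (by rwa [Triple.dual_dual])⟩

/-! ### Realizations of the Witt algebras -/

variable {g : WittKind}

theorem restrictSl2_L (ρ : g.Alg →ₗ⁅ℂ⁆ Diff D) {i : ℤ} (hi : -1 ≤ i ∧ i ≤ 1) :
    restrictSl2 D g ρ (Sl2.L i hi) = ρ (g.L i (g.mem_supp hi)) :=
  congrArg ρ (g.ofSl2_L i hi)

theorem restrictSl2_mem_iff {ρ : g.Alg →ₗ⁅ℂ⁆ Diff D} :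
    restrictSl2 D g ρ ∈ SlRealizations D ↔ ρ ∈ Realizations D g := by
  change HasOrder D _ 1 ↔ HasOrder D _ 1
  rw [restrictSl2_L]

theorem restrictSl2_mem_of_iff {ρ : g.Alg →ₗ⁅ℂ⁆ Diff D} {k : ℕ} :
    restrictSl2 D g ρ ∈ SlRealizationsOf D k ↔ ρ ∈ RealizationsOf D g k := by
  change _ ∧ HasOrder D _ k ↔ _ ∧ HasOrder D _ k
  rw [restrictSl2_mem_iff, restrictSl2_L]

/-- A realization whose `L 0` is `-(h / h') ∂ + b` consists of homogeneous operators. -/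
theorem exists_wt_family (hV : IsRationalFunctions D ∨ IsLaurentSeries D)
    {ρ : g.Alg →ₗ⁅ℂ⁆ Diff D} {t : Triple V} (ht : D t.h ≠ 0)
    (h0 : (restrictSl2 D g ρ (Sl2.L 0 (by norm_num)) : Module.End ℂ V) = wt D t 0 X) :
    ∃ q : ℤ → ℂ[X], (∀ i hi, (ρ (g.L i hi) : Module.End ℂ V) = wt D t i (q i)) ∧
      ∀ i j, i ∈ g.supp → j ∈ g.supp → i + j ∈ g.supp →
        (i + j ≠ 0 ∨ i = -1 ∨ i = 0 ∨ i = 1) →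
        wtBracket i j (q i) (q j) = ((i : ℂ) - j) • q (i + j) := by
  have hbr : ∀ (i j : ℤ) (hi : i ∈ g.supp) (hj : j ∈ g.supp) (hij : i + j ∈ g.supp),
      (i + j ≠ 0 ∨ i = -1 ∨ i = 0 ∨ i = 1) →
      (ρ (g.L i hi) : Module.End ℂ V) * ρ (g.L j hj) - ρ (g.L j hj) * ρ (g.L i hi) =
        ((i : ℂ) - j) • (ρ (g.L (i + j) hij) : Module.End ℂ V) :=
    fun i j hi hj hij h => by
      rw [← Diff.coe_lie, ← LieHom.map_lie, g.lie_L hi hj hij h, map_smul]; rfl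
  rw [restrictSl2_L, wt_zero_X] at h0
  have hex : ∀ i, ∃ q : ℂ[X], ∀ hi, (ρ (g.L i hi) : Module.End ℂ V) = wt D t i q := by
    intro i
    by_cases hi : i ∈ g.supp
    · obtain ⟨q, hq⟩ := exists_eq_wt hV ht (i := i) (ρ (g.L i hi)).2 (by
        have h := hbr 0 i (g.mem_supp (by norm_num)) hi (by rwa [zero_add]) (by simp)
        rw [h0] at h
        simpa using h)
      exact ⟨q, fun _ => hq⟩
    · exact ⟨0, fun h => absurd h hi⟩
  choose q hq using hex
  refine ⟨q, hq, fun i j hi hj hij h => wt_injective ht (i + j) ?_⟩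
  have e := hbr i j hi hj hij h
  rw [hq, hq, hq, wt_commutator ht, ← map_smul] at e
  exact e

theorem exists_hom_wt {t : Triple V} (ht : D t.h ≠ 0) {q : ℤ → ℂ[X]}
    (hq : ∀ i ∈ g.supp, ∀ j ∈ g.supp, i + j ∈ g.supp →
      wtBracket i j (q i) (q j) = ((i : ℂ) - j) • q (i + j)) :
    ∃ ρ : g.Alg →ₗ⁅ℂ⁆ Diff D, ∀ i hi, (ρ (g.L i hi) : Module.End ℂ V) = wt D t i (q i) := by
  obtain ⟨ρ, hρ⟩ := g.exists_hom (M := Diff D)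
    (v := fun i => ⟨wt D t i (q i), wt_mem_Diff ht i (q i)⟩) (fun i hi j hj hij => Subtype.ext (by
      rw [Diff.coe_lie, wt_commutator ht, hq i hi j hj hij, map_smul]; rfl))
  exact ⟨ρ, fun i hi => by rw [hρ i hi]⟩

theorem WittKind.sub_one_mem_supp {i : ℤ} (h : i ∈ g.supp) (hi : 0 ≤ i) : i - 1 ∈ g.supp := by
  cases g with
  | pos => change -1 ≤ i - 1; omega
  | neg => change i - 1 ≤ 1; change i ≤ 1 at h; omega
  | full => trivial
  | vir => trivial

theorem WittKind.add_one_mem_supp {i : ℤ} (h : i ∈ g.supp) (hi : i ≤ 0) : i + 1 ∈ g.supp := by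
  cases g with
  | pos => change -1 ≤ i + 1; change -1 ≤ i at h; omega
  | neg => change i + 1 ≤ 1; omega
  | full => trivial
  | vir => trivial

/-! #### The case of order one -/

/-- Induct away from weight 0, upwards by `[L (-1), ·]` and downwards by `[L 1, ·]`. The difference
between `q i` and `x + ic` is annihilated by the bracket, hence zero. -/
theorem eq_opOne_of_isTripleOne (hV : IsRationalFunctions D ∨ IsLaurentSeries D)
    {ρ : g.Alg →ₗ⁅ℂ⁆ Diff D} {t : Triple V} (ht : D t.h ≠ 0)
    (h : IsTripleOne D (restrictSl2 D g ρ) t) (i : ℤ) (hi : i ∈ g.supp) :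
    (ρ (g.L i hi) : Module.End ℂ V) = opOne D t i := by
  obtain ⟨hm, h0, h1⟩ := (isTripleOne_iff ht).mp h
  obtain ⟨q, hq, hbr⟩ := exists_wt_family hV ht h0
  rw [restrictSl2_L, hq] at hm h0 h1
  replace hm := wt_injective ht _ hm
  replace h0 := wt_injective ht _ h0
  replace h1 := wt_injective ht _ h1
  have hmsupp : (-1 : ℤ) ∈ g.supp := g.mem_supp (by norm_num)
  have h1supp : (1 : ℤ) ∈ g.supp := g.mem_supp (by norm_num)
  have em : (X + C (((-1 : ℤ) : ℂ) * t.c) : ℂ[X]) = X - C t.c := by simp [sub_eq_add_neg]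
  have e1 : (X + C (((1 : ℤ) : ℂ) * t.c) : ℂ[X]) = X + C t.c := by simp
  have hnn : ∀ n : ℕ, (n : ℤ) ∈ g.supp → q n = X + C (((n : ℤ) : ℂ) * t.c) := by
    intro n
    induction n with
    | zero => intro _; simpa using h0
    | succ n ih =>
      intro hn
      have hn' : -1 + ((n + 1 : ℕ) : ℤ) = n := by push_cast; ring
      have hns : (n : ℤ) ∈ g.supp := by
        rw [← hn', neg_add_eq_sub]
        exact WittKind.sub_one_mem_supp hn (by omega)
      have a1 := hbr (-1) ((n + 1 : ℕ) : ℤ) hmsupp hn (by rwa [hn']) (by simp)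
      have a2 := wtBracket_order_one t.c (-1) ((n + 1 : ℕ) : ℤ)
      rw [hn', hm, ih hns] at a1
      rw [hn', em] at a2
      rw [← sub_eq_zero]
      refine eq_zero_of_wtBracket_lower (c := t.c) (Nat.succ_ne_zero n) ?_
      rw [wtBracket_sub_right, a1, a2, sub_self]
  have hneg : ∀ n : ℕ, (-n : ℤ) ∈ g.supp → q (-n) = X + C (((-n : ℤ) : ℂ) * t.c) := by
    intro n
    induction n with
    | zero => intro _; simpa using h0
    | succ n ih =>
      intro hn
      have hn' : 1 + -((n + 1 : ℕ) : ℤ) = -n := by push_cast; ring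
      have hns : (-n : ℤ) ∈ g.supp := by
        rw [← hn', add_comm]
        exact WittKind.add_one_mem_supp hn (by omega)
      have a1 := hbr 1 (-((n + 1 : ℕ) : ℤ)) h1supp hn (by rwa [hn']) (by simp)
      have a2 := wtBracket_order_one t.c 1 (-((n + 1 : ℕ) : ℤ))
      rw [hn', h1, ih hns] at a1
      rw [hn', e1] at a2
      rw [← sub_eq_zero]
      refine eq_zero_of_wtBracket_raise (c := t.c) (Nat.succ_ne_zero n) ?_
      rw [wtBracket_sub_right, a1, a2, sub_self]
  rw [hq, opOne_eq_wt ht]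
  obtain ⟨n, rfl | rfl⟩ := i.eq_nat_or_neg
  · rw [hnn n hi]
  · rw [hneg n hi]

/-- The operators of order one already satisfy `[L 2, L (-2)] = 4 L 0`, so the extra term `K / 2`
acts as zero. -/
theorem map_K_eq_zero (hV : IsRationalFunctions D ∨ IsLaurentSeries D)
    {ρ : WittKind.vir.Alg →ₗ⁅ℂ⁆ Diff D} {t : Triple V} (ht : D t.h ≠ 0)
    (h : IsTripleOne D (restrictSl2 D WittKind.vir ρ) t) : ρ Vir.K = 0 := by
  have hL := eq_opOne_of_isTripleOne hV ht h
  have hmem : ∀ i, i ∈ WittKind.vir.supp := fun _ => trivial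
  have e0 : ⁅WittKind.vir.L 2 (hmem 2), WittKind.vir.L (-2) (hmem (-2))⁆ =
      (4 : ℂ) • WittKind.vir.L 0 (hmem 0) + (1 / 2 : ℂ) • (show WittKind.vir.Alg from Vir.K) :=
    Vir.lie_two_neg_two
  have e1 := congrArg ρ e0
  rw [LieHom.map_lie, map_add, map_smul, map_smul] at e1
  have e2 := congrArg (fun P : Diff D => (P : Module.End ℂ V)) e1
  change ((⁅ρ (WittKind.vir.L 2 (hmem 2)), ρ (WittKind.vir.L (-2) (hmem (-2)))⁆ : Diff D) :
      Module.End ℂ V) = (4 : ℂ) • (ρ (WittKind.vir.L 0 (hmem 0)) : Module.End ℂ V) +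
        (1 / 2 : ℂ) • (ρ Vir.K : Module.End ℂ V) at e2
  rw [Diff.coe_lie, hL, hL, hL, opOne_eq_wt ht, opOne_eq_wt ht, opOne_eq_wt ht,
    wt_commutator ht, wtBracket_order_one, map_smul] at e2
  norm_num at e2
  exact e2

theorem restrictSl2_bijOn_one (hV : IsRationalFunctions D ∨ IsLaurentSeries D) (g : WittKind) :
    Set.BijOn (restrictSl2 D g) (RealizationsOf D g 1) (SlRealizationsOf D 1) := by
  refine ⟨fun ρ hρ => restrictSl2_mem_of_iff.mpr hρ, fun ρ hρ ρ' hρ' h => ?_, fun σ hσ => ?_⟩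
  · obtain ⟨t, ht, htr⟩ := exists_isTripleOne hV (restrictSl2_mem_of_iff.mpr hρ)
    have htr' := htr
    rw [h] at htr'
    refine g.hom_ext (fun i hi => Subtype.ext ?_) ?_
    · rw [eq_opOne_of_isTripleOne hV ht htr i hi, eq_opOne_of_isTripleOne hV ht htr' i hi]
    · rintro rfl
      exact (map_K_eq_zero hV ht htr).trans (map_K_eq_zero hV ht htr').symm
  · obtain ⟨t, ht, htr⟩ := exists_isTripleOne hV hσ
    obtain ⟨ρ, hρ⟩ := exists_hom_wt (g := g) (D := D) (t := t) ht
      (q := fun i => X + C (i * t.c)) (fun i _ j _ _ => wtBracket_order_one t.c i j)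
    have h : restrictSl2 D g ρ = σ := IsTripleOne.hom_unique (t := t)
      (fun i hi => by rw [restrictSl2_L, hρ, opOne_eq_wt ht]) htr
    exact ⟨ρ, restrictSl2_mem_of_iff.mp (h ▸ hσ), h⟩

theorem isBijectiveRel_one (hV : IsRationalFunctions D ∨ IsLaurentSeries D) :
    IsBijectiveRel (SlRealizationsOf D 1) (TriplesOne D) (IsTripleOne D) := by
  refine ⟨fun σ hσ => ?_, fun t ht => ?_⟩
  · obtain ⟨t, ht, h⟩ := exists_isTripleOne hV hσ
    exact ⟨t, ⟨ht, h⟩, fun t' ht' => IsTripleOne.unique ht'.1 ht ht'.2 h⟩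
  -- The realization of `sl(2)` is obtained by restricting one of `Witt`.
  · obtain ⟨ρ, hρ⟩ := exists_hom_wt (g := WittKind.full) (D := D) (t := t) ht
      (q := fun i => X + C (i * t.c)) (fun i _ j _ _ => wtBracket_order_one t.c i j)
    have h : IsTripleOne D (restrictSl2 D WittKind.full ρ) t :=
      fun i hi => by rw [restrictSl2_L, hρ, opOne_eq_wt ht]
    exact ⟨_, ⟨h.mem ht, h⟩, fun σ hσ => hσ.2.hom_unique h⟩

/-! #### The case of order zero -/

theorem exists_raise {t : Triple V} (ht : D t.h ≠ 0) {l : ℂ} (hl : l = t.c ∨ l = -t.c - 1) :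
    ∃ ρ : WittKind.pos.Alg →ₗ⁅ℂ⁆ Diff D,
      IsTripleZero D (restrictSl2 D WittKind.pos ρ) t ∧
      ∀ i hi, (ρ (WittKind.pos.L i hi) : Module.End ℂ V) = wt D t i (raisePoly l i) := by
  obtain ⟨ρ, hρ⟩ := exists_hom_wt (g := WittKind.pos) ht (q := raisePoly l)
    (fun i hi j hj _ => wtBracket_raisePoly l hi hj)
  refine ⟨ρ, isTripleZero_iff.mpr ?_, hρ⟩
  rw [restrictSl2_L, restrictSl2_L, restrictSl2_L, hρ, hρ, hρ, raisePoly_neg_one, raisePoly_zero,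
    raisePoly_one_eq hl]
  exact ⟨rfl, rfl, rfl⟩

theorem exists_eq_wt_raisePoly (hV : IsRationalFunctions D ∨ IsLaurentSeries D)
    {ρ : WittKind.pos.Alg →ₗ⁅ℂ⁆ Diff D} {t : Triple V} (ht : D t.h ≠ 0)
    (h : IsTripleZero D (restrictSl2 D WittKind.pos ρ) t) :
    ∃ l : ℂ, (l = t.c ∨ l = -t.c - 1) ∧
      ∀ i hi, (ρ (WittKind.pos.L i hi) : Module.End ℂ V) = wt D t i (raisePoly l i) := by
  obtain ⟨hm, h0, h1⟩ := isTripleZero_iff.mp h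
  obtain ⟨q, hq, hbr⟩ := exists_wt_family hV ht h0
  rw [restrictSl2_L, hq] at hm h0 h1
  replace hm := wt_injective ht _ hm
  replace h0 := wt_injective ht _ h0
  replace h1 := wt_injective ht _ h1
  obtain ⟨l, hl, hn⟩ := exists_eq_raisePoly (c := t.c) (q := q) hm h1 (fun i j hi hj hij => by
    by_cases hij' : -1 ≤ i + j
    · exact hbr i j hi hj hij' (Or.inl hij)
    -- The index `-2` is outside the support, but there the coefficient `i - j` is zero.
    · obtain rfl : i = -1 := by omega
      obtain rfl : j = -1 := by omega
      simp [wtBracket])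
  refine ⟨l, hl, fun i hi => ?_⟩
  rw [hq]
  congr 1
  have hi' : -1 ≤ i := hi
  obtain rfl | rfl | hi'' : i = -1 ∨ i = 0 ∨ 1 ≤ i := by omega
  · rw [hm, raisePoly_neg_one]
  · rw [h0, raisePoly_zero]
  · lift i to ℕ using (by omega)
    exact hn i (by omega)

theorem WittKind.pos_hom_ext {t : Triple V} {q : ℤ → ℂ[X]} {ρ ρ' : WittKind.pos.Alg →ₗ⁅ℂ⁆ Diff D}
    (h : ∀ i hi, (ρ (WittKind.pos.L i hi) : Module.End ℂ V) = wt D t i (q i))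
    (h' : ∀ i hi, (ρ' (WittKind.pos.L i hi) : Module.End ℂ V) = wt D t i (q i)) : ρ = ρ' :=
  WittKind.pos.hom_ext (fun i hi => Subtype.ext ((h i hi).trans (h' i hi).symm))
    (fun h => WittKind.noConfusion h)

theorem isBijectiveRel_zero (hV : IsRationalFunctions D ∨ IsLaurentSeries D) :
    IsBijectiveRel (SlRealizationsOf D 0) (TriplesZero D) (IsTripleZero D) := by
  refine ⟨fun σ hσ => ?_, fun t ht => ?_⟩
  · obtain ⟨t, ht, h⟩ := exists_isTripleZero hV hσ
    exact ⟨t, ⟨ht, h⟩, fun t' ht' => IsTripleZero.unique ht'.1 ht ht'.2 h⟩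
  · obtain ⟨ρ, h, -⟩ := exists_raise ht.1 (l := t.c) (Or.inl rfl)
    exact ⟨_, ⟨h.mem ht.1, h⟩, fun σ hσ => hσ.2.hom_unique h⟩

theorem surjOn_pos_zero (hV : IsRationalFunctions D ∨ IsLaurentSeries D) :
    Set.SurjOn (restrictSl2 D WittKind.pos)
      (RealizationsOf D WittKind.pos 0) (SlRealizationsOf D 0) := by
  intro σ hσ
  obtain ⟨t, ht, h⟩ := exists_isTripleZero hV hσ
  obtain ⟨ρ, hρ, -⟩ := exists_raise ht.1 (l := t.c) (Or.inl rfl)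
  have e := hρ.hom_unique h
  exact ⟨ρ, restrictSl2_mem_of_iff.mp (e ▸ hσ), e⟩

/-- The fiber consists of the realizations for `λ = c` and `λ = -c-1`, which already differ at `L 2`
unless `c` is `0` or `-1/2`. -/
theorem encard_fiber_pos_zero (hV : IsRationalFunctions D ∨ IsLaurentSeries D)
    {σ : Sl2 →ₗ⁅ℂ⁆ Diff D} (hσ : σ ∈ SlRealizationsOf D 0) {t : Triple V}
    (ht : t ∈ TriplesZero D) (h : IsTripleZero D σ t) :
    {ρ ∈ RealizationsOf D WittKind.pos 0 | restrictSl2 D WittKind.pos ρ = σ}.encard =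
      if t.c = 0 ∨ t.c = -1 / 2 then 1 else 2 := by
  obtain ⟨ρ₁, h₁, hρ₁⟩ := exists_raise ht.1 (l := t.c) (Or.inl rfl)
  obtain ⟨ρ₂, h₂, hρ₂⟩ := exists_raise ht.1 (l := -t.c - 1) (Or.inr rfl)
  have hset : {ρ ∈ RealizationsOf D WittKind.pos 0 | restrictSl2 D WittKind.pos ρ = σ} =
      {ρ₁, ρ₂} := by
    ext ρ
    constructor
    · rintro ⟨-, rfl⟩
      obtain ⟨l, rfl | rfl, hl⟩ := exists_eq_wt_raisePoly hV ht.1 h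
      · exact Or.inl (WittKind.pos_hom_ext hl hρ₁)
      · exact Or.inr (WittKind.pos_hom_ext hl hρ₂)
    · rintro (rfl | rfl)
      · have e := h₁.hom_unique h
        exact ⟨restrictSl2_mem_of_iff.mp (e ▸ hσ), e⟩
      · have e := h₂.hom_unique h
        exact ⟨restrictSl2_mem_of_iff.mp (e ▸ hσ), e⟩
  rw [hset]
  split_ifs with hc
  · have e : ρ₁ = ρ₂ := by
      refine WittKind.pos_hom_ext hρ₁ fun i hi => ?_
      rw [hρ₂]
      congr 1
      have hi' : -1 ≤ i := hi
      obtain rfl | rfl | hi'' : i = -1 ∨ i = 0 ∨ 1 ≤ i := by omega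
      · rfl
      · rw [raisePoly_zero, raisePoly_zero]
      · lift i to ℕ using (by omega)
        exact raisePoly_eq_of_zero_or_half hc (by omega)
    rw [e, Set.pair_eq_singleton, Set.encard_singleton]
  · refine Set.encard_pair fun e => ?_
    push Not at hc
    refine raisePoly_two_injective ht.2 hc.1 hc.2 (wt_injective ht.1 2 ?_)
    have hi : (2 : ℤ) ∈ WittKind.pos.supp := show (-1 : ℤ) ≤ 2 by norm_num
    rw [← hρ₁ 2 hi, ← hρ₂ 2 hi, e]

theorem wt_raisePoly_natCast (t : Triple V) (l : ℂ) (n : ℕ) : wt D t n (raisePoly l n) =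
    t.h ^ n • ((opZero D t + scal (n * l)) * poch (opZero D t - scal (l + n)) n) := by
  rw [wt_apply, zpow_natCast, raisePoly_natCast, map_mul, map_add, aeval_X, aeval_C, shiftPoch,
    aeval_comp, map_sub, aeval_X, aeval_C]
  rfl

/-! #### Emptiness -/

/-- The obstruction is `[L 1, L (-2)] = 3 L (-1)`, whose right side has constant weight polynomial.
-/
theorem realizationsOf_zero_eq_empty (hV : IsRationalFunctions D ∨ IsLaurentSeries D)
    (hg : (-2 : ℤ) ∈ g.supp) : RealizationsOf D g 0 = ∅ := by
  refine Set.eq_empty_of_forall_notMem fun ρ hρ => ?_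
  obtain ⟨t, ht, h⟩ := exists_isTripleZero hV (restrictSl2_mem_of_iff.mpr hρ)
  obtain ⟨hm, h0, h1⟩ := isTripleZero_iff.mp h
  obtain ⟨q, hq, hbr⟩ := exists_wt_family hV ht.1 h0
  rw [restrictSl2_L, hq] at hm h0 h1
  replace hm := wt_injective ht.1 _ hm
  replace h1 := wt_injective ht.1 _ h1
  have e := hbr 1 (-2) (g.mem_supp (by norm_num)) hg (g.mem_supp (by norm_num)) (by simp)
  norm_num at e
  rw [h1, hm] at e
  exact no_lowering (a := 3) (by norm_num) (e.trans (by simp [smul_eq_C_mul]))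

theorem realizationsOf_two_eq_empty (hV : IsRationalFunctions D ∨ IsLaurentSeries D)
    (hg : (2 : ℤ) ∈ g.supp) : RealizationsOf D g 2 = ∅ := by
  refine Set.eq_empty_of_forall_notMem fun ρ hρ => ?_
  obtain ⟨t, ht, h⟩ := exists_isTripleTwo hV (restrictSl2_mem_of_iff.mpr hρ)
  obtain ⟨hm, h0, h1⟩ := isTripleTwo_iff.mp h
  obtain ⟨q, hq, hbr⟩ := exists_wt_family hV ht.1 h0
  rw [restrictSl2_L, hq] at hm h0 h1
  replace hm := wt_injective ht.1 _ hm
  replace h1 := wt_injective ht.1 _ h1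
  have e := hbr (-1) 2 (g.mem_supp (by norm_num)) hg (g.mem_supp (by norm_num)) (by simp)
  norm_num at e
  rw [h1, hm] at e
  exact no_raising (a := -3) (by norm_num) (e.trans (by simp [smul_eq_C_mul]))

/-! #### The case of order two -/

/-- Restriction to `sl(2)` commutes definitionally with the involution, so the claim is one about
`sl(2)`. -/
theorem comp_chevalleyNegPos_mem (hV : IsRationalFunctions D ∨ IsLaurentSeries D) {k l : ℕ}
    (hkl : k + l = 2) {ρ : WittKind.pos.Alg →ₗ⁅ℂ⁆ Diff D}
    (hρ : ρ ∈ RealizationsOf D WittKind.pos k) :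
    ρ.comp chevalleyNegPos ∈ RealizationsOf D WittKind.neg l :=
  restrictSl2_mem_of_iff.mp (comp_chevalleySl2_mem hV hkl (restrictSl2_mem_of_iff.mpr hρ))

theorem comp_chevalleyPosNeg_mem (hV : IsRationalFunctions D ∨ IsLaurentSeries D) {k l : ℕ}
    (hkl : k + l = 2) {ρ : WittKind.neg.Alg →ₗ⁅ℂ⁆ Diff D}
    (hρ : ρ ∈ RealizationsOf D WittKind.neg k) :
    ρ.comp chevalleyPosNeg ∈ RealizationsOf D WittKind.pos l :=
  restrictSl2_mem_of_iff.mp (comp_chevalleySl2_mem hV hkl (restrictSl2_mem_of_iff.mpr hρ))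

theorem bijOn_comp_chevalleyNegPos (hV : IsRationalFunctions D ∨ IsLaurentSeries D) {k l : ℕ}
    (hkl : k + l = 2) :
    Set.BijOn (fun ρ : WittKind.pos.Alg →ₗ⁅ℂ⁆ Diff D => ρ.comp chevalleyNegPos)
      (RealizationsOf D WittKind.pos k) (RealizationsOf D WittKind.neg l) :=
  Set.InvOn.bijOn (f' := fun ρ => ρ.comp chevalleyPosNeg)
    ⟨fun ρ _ => comp_chevalleyPosNeg_comp ρ, fun ρ _ => comp_chevalleyNegPos_comp ρ⟩
    (fun _ hρ => comp_chevalleyNegPos_mem hV hkl hρ)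
    (fun _ hρ => comp_chevalleyPosNeg_mem hV (by omega) hρ)

theorem bijOn_comp_chevalleyPosNeg (hV : IsRationalFunctions D ∨ IsLaurentSeries D) {k l : ℕ}
    (hkl : k + l = 2) :
    Set.BijOn (fun ρ : WittKind.neg.Alg →ₗ⁅ℂ⁆ Diff D => ρ.comp chevalleyPosNeg)
      (RealizationsOf D WittKind.neg k) (RealizationsOf D WittKind.pos l) :=
  Set.InvOn.bijOn (f' := fun ρ => ρ.comp chevalleyNegPos)
    ⟨fun ρ _ => comp_chevalleyNegPos_comp ρ, fun ρ _ => comp_chevalleyPosNeg_comp ρ⟩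
    (fun _ hρ => comp_chevalleyPosNeg_mem hV hkl hρ)
    (fun _ hρ => comp_chevalleyNegPos_mem hV (by omega) hρ)

theorem isBijectiveRel_two (hV : IsRationalFunctions D ∨ IsLaurentSeries D) :
    IsBijectiveRel (SlRealizationsOf D 2) (TriplesZero D) (IsTripleTwo D) := by
  obtain ⟨h1, h2⟩ := isBijectiveRel_zero hV
  refine ⟨fun σ hσ => ?_, fun t ht => ?_⟩
  · obtain ⟨t, ht, h⟩ := exists_isTripleTwo hV hσ
    refine ⟨t, ⟨ht, h⟩, fun t' ht' => ?_⟩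
    have e := IsTripleZero.unique (dual_mem_triplesZero ht'.1) (dual_mem_triplesZero ht)
      ((isTripleTwo_iff_dual ht'.1.1).mp ht'.2) ((isTripleTwo_iff_dual ht.1).mp h)
    rw [← t'.dual_dual, e, t.dual_dual]
  · obtain ⟨σ, ⟨hσ, h⟩, hu⟩ := h2 t.dual (dual_mem_triplesZero ht)
    refine ⟨σ.comp chevalleySl2, ⟨comp_chevalleySl2_mem hV (k := 0) rfl hσ,
      (isTripleTwo_iff_dual ht.1).mpr (by rwa [chevalleySl2_comp_self])⟩, fun σ' hσ' => ?_⟩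
    rw [← hu (σ'.comp chevalleySl2) ⟨comp_chevalleySl2_mem hV (k := 2) rfl hσ'.1,
      (isTripleTwo_iff_dual ht.1).mp hσ'.2⟩, chevalleySl2_comp_self]

/-- The involution carries this fiber bijectively onto the order zero fiber over the dual triple,
which has the same `c`. -/
theorem encard_fiber_neg_two (hV : IsRationalFunctions D ∨ IsLaurentSeries D)
    {σ : Sl2 →ₗ⁅ℂ⁆ Diff D} (hσ : σ ∈ SlRealizationsOf D 2) {t : Triple V}
    (ht : t ∈ TriplesZero D) (h : IsTripleTwo D σ t) :
    {ρ ∈ RealizationsOf D WittKind.neg 2 | restrictSl2 D WittKind.neg ρ = σ}.encard =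
      if t.c = 0 ∨ t.c = -1 / 2 then 1 else 2 := by
  have e := encard_fiber_pos_zero hV (comp_chevalleySl2_mem hV (k := 2) rfl hσ)
    (dual_mem_triplesZero ht) ((isTripleTwo_iff_dual ht.1).mp h)
  refine Eq.trans ?_ e
  have hinj : Function.Injective
      (fun ρ : WittKind.neg.Alg →ₗ⁅ℂ⁆ Diff D => ρ.comp chevalleyPosNeg) :=
    Function.LeftInverse.injective (g := fun ρ => ρ.comp chevalleyNegPos)
      fun ρ => comp_chevalleyNegPos_comp ρ
  rw [← hinj.encard_image]
  congr 1
  ext ρ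
  constructor
  · rintro ⟨ρ', ⟨hρ', rfl⟩, rfl⟩
    exact ⟨comp_chevalleyPosNeg_mem hV rfl hρ', rfl⟩
  · rintro ⟨hρ, hr⟩
    refine ⟨ρ.comp chevalleyNegPos, ⟨comp_chevalleyNegPos_mem hV rfl hρ, ?_⟩,
      comp_chevalleyPosNeg_comp ρ⟩
    have e : restrictSl2 D WittKind.neg (ρ.comp chevalleyNegPos) =
      (restrictSl2 D WittKind.pos ρ).comp chevalleySl2 := rfl
    rw [e, hr, chevalleySl2_comp_self]

theorem surjOn_neg_two (hV : IsRationalFunctions D ∨ IsLaurentSeries D) :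
    Set.SurjOn (restrictSl2 D WittKind.neg)
      (RealizationsOf D WittKind.neg 2) (SlRealizationsOf D 2) := by
  intro σ hσ
  obtain ⟨ρ, hρ, h⟩ := surjOn_pos_zero hV (comp_chevalleySl2_mem hV (k := 2) rfl hσ)
  refine ⟨ρ.comp chevalleyNegPos, comp_chevalleyNegPos_mem hV rfl hρ, ?_⟩
  have e : restrictSl2 D WittKind.neg (ρ.comp chevalleyNegPos) =
    (restrictSl2 D WittKind.pos ρ).comp chevalleySl2 := rfl
  rw [e, h, chevalleySl2_comp_self]

/-- The polynomial `(x - l - n) ⋯ (x - l - 1)` at `-x`. -/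
theorem shiftPoch_comp_neg (l : ℂ) (n : ℕ) : (shiftPoch l n).comp (-X) =
    (-1 : ℂ) ^ n • (ascPochhammer ℂ n).comp (X + C (l + 1)) := by
  refine Polynomial.funext fun x => ?_
  simp only [eval_comp, eval_neg, eval_X, eval_smul, smul_eq_mul, eval_add, eval_C]
  induction n with
  | zero => simp [shiftPoch_zero]
  | succ n ih =>
    rw [eval_shiftPoch_succ, ih, ascPochhammer_succ_eval, pow_succ]
    ring

theorem exists_eq_lower (hV : IsRationalFunctions D ∨ IsLaurentSeries D)
    {ρ : WittKind.neg.Alg →ₗ⁅ℂ⁆ Diff D} {t : Triple V} (ht : D t.h ≠ 0)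
    (h : IsTripleTwo D (restrictSl2 D WittKind.neg ρ) t) :
    ∃ l : ℂ, (l = t.c ∨ l = -t.c - 1) ∧
      ∀ (n : ℕ) (hi : -(n : ℤ) ∈ WittKind.neg.supp),
        (ρ (WittKind.neg.L (-n) hi) : Module.End ℂ V) =
          t.h⁻¹ ^ n • ((opZero D t - scal (n * l)) * poch (opZero D t + scal (l + 1)) n) := by
  obtain ⟨l, hl, hq⟩ := exists_eq_wt_raisePoly hV (der_dual_ne_zero ht)
    (ρ := ρ.comp chevalleyPosNeg) ((isTripleTwo_iff_dual ht).mp h)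
  refine ⟨l, hl, fun n hi => ?_⟩
  have hn : (n : ℤ) ∈ WittKind.pos.supp := show -1 ≤ (n : ℤ) by omega
  have e := hq n hn
  rw [LieHom.comp_apply, chevalleyPosNeg_L, map_smul, wt_dual ht] at e
  change (-1 : ℂ) ^ ((n : ℤ) + 1) • (ρ (WittKind.neg.L (-n) hi) : Module.End ℂ V) = _ at e
  -- The sign produced by `x ↦ -x` cancels the sign in the Chevalley involution.
  have hpoly : (raisePoly l n).comp (-X) =
      (-1 : ℂ) ^ ((n : ℤ) + 1) • ((X - C (n * l)) * (ascPochhammer ℂ n).comp (X + C (l + 1))) := by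
    rw [raisePoly_natCast, mul_comp, shiftPoch_comp_neg, zpow_add₀ (by norm_num), zpow_natCast,
      zpow_one, mul_smul, neg_smul, one_smul, mul_smul_comm, add_comp, X_comp, C_comp]
    congr 1
    ring
  rw [hpoly, map_smul] at e
  rw [smul_right_injective _ (zpow_ne_zero _ (by norm_num)) e, wt_apply, map_mul, map_sub, aeval_X,
    aeval_C, aeval_comp, map_add, aeval_X, aeval_C, zpow_neg, zpow_natCast, ← inv_pow]
  rfl

end Realizations

end

theorem theoremt {V : Type*} [Field V] [Algebra ℂ V] (D : Derivation ℂ V V)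
    (hV : IsRationalFunctions D ∨ IsLaurentSeries D) :
    -- the triple associated to a realization of `sl(2)` is well defined
    (IsBijectiveRel (SlRealizationsOf D 0) (TriplesZero D) (IsTripleZero D) ∧
      IsBijectiveRel (SlRealizationsOf D 1) (TriplesOne D) (IsTripleOne D) ∧
      IsBijectiveRel (SlRealizationsOf D 2) (TriplesZero D) (IsTripleTwo D)) ∧
    -- statements about each of `Witt_>`, `Witt_<`, `Witt`, `Vir`
    (∀ g : WittKind,
      (Realizations D g = RealizationsOf D g 0 ∪ RealizationsOf D g 1 ∪ RealizationsOf D g 2 ∧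
        Disjoint (RealizationsOf D g 0) (RealizationsOf D g 1) ∧
        Disjoint (RealizationsOf D g 0) (RealizationsOf D g 2) ∧
        Disjoint (RealizationsOf D g 1) (RealizationsOf D g 2)) ∧
      Set.MapsTo (restrictSl2 D g) (Realizations D g) (SlRealizations D) ∧
      Set.BijOn (restrictSl2 D g) (RealizationsOf D g 1) (SlRealizationsOf D 1) ∧
      (∀ k : ℕ, k = 0 ∨ k = 2 →
        Set.MapsTo (restrictSl2 D g) (RealizationsOf D g k) (SlRealizationsOf D k) ∧
        ∀ σ ∈ SlRealizationsOf D k,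
          {ρ ∈ RealizationsOf D g k | restrictSl2 D g ρ = σ}.encard ≤ 2) ∧
      (∀ ρ ∈ RealizationsOf D g 1, ∀ t ∈ TriplesOne D, IsTripleOne D (restrictSl2 D g ρ) t →
        ∀ (i : ℤ) (hi : i ∈ g.supp), (ρ (g.L i hi) : Module.End ℂ V) = opOne D t i)) ∧
    -- the central charge vanishes on `R_1(Vir)`
    (∀ ρ ∈ RealizationsOf D WittKind.vir 1, ρ Vir.K = 0) ∧
    -- the realizations in `R_0(Witt_>)`
    (∀ ρ ∈ RealizationsOf D WittKind.pos 0, ∀ t ∈ TriplesZero D,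
      IsTripleZero D (restrictSl2 D WittKind.pos ρ) t →
      ∃ l : ℂ, (l = t.c ∨ l = -t.c - 1) ∧
        (∀ hi, (ρ (WittKind.pos.L 0 hi) : Module.End ℂ V) = opZero D t) ∧
        (∀ hi, (ρ (WittKind.pos.L (-1) hi) : Module.End ℂ V) = t.h⁻¹ • 1) ∧
        ∀ (n : ℕ) (hi : (n : ℤ) ∈ WittKind.pos.supp), n ≠ 0 →
          (ρ (WittKind.pos.L n hi) : Module.End ℂ V) =
            t.h ^ n • ((opZero D t + scal (n * l)) * poch (opZero D t - scal (l + n)) n)) ∧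
    Set.SurjOn (restrictSl2 D WittKind.pos)
      (RealizationsOf D WittKind.pos 0) (SlRealizationsOf D 0) ∧
    (∀ σ ∈ SlRealizationsOf D 0, ∀ t ∈ TriplesZero D, IsTripleZero D σ t →
      {ρ ∈ RealizationsOf D WittKind.pos 0 | restrictSl2 D WittKind.pos ρ = σ}.encard =
        if t.c = 0 ∨ t.c = -1 / 2 then 1 else 2) ∧
    -- the realizations in `R_2(Witt_<)`
    (∀ ρ ∈ RealizationsOf D WittKind.neg 2, ∀ t ∈ TriplesZero D,
      IsTripleTwo D (restrictSl2 D WittKind.neg ρ) t →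
      ∃ l : ℂ, (l = t.c ∨ l = -t.c - 1) ∧
        (∀ hi, (ρ (WittKind.neg.L 0 hi) : Module.End ℂ V) = opZero D t) ∧
        (∀ hi, (ρ (WittKind.neg.L 1 hi) : Module.End ℂ V) = t.h • 1) ∧
        ∀ (n : ℕ) (hi : -(n : ℤ) ∈ WittKind.neg.supp), n ≠ 0 →
          (ρ (WittKind.neg.L (-n) hi) : Module.End ℂ V) =
            t.h⁻¹ ^ n • ((opZero D t - scal (n * l)) * poch (opZero D t + scal (l + 1)) n)) ∧
    Set.SurjOn (restrictSl2 D WittKind.neg)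
      (RealizationsOf D WittKind.neg 2) (SlRealizationsOf D 2) ∧
    (∀ σ ∈ SlRealizationsOf D 2, ∀ t ∈ TriplesZero D, IsTripleTwo D σ t →
      {ρ ∈ RealizationsOf D WittKind.neg 2 | restrictSl2 D WittKind.neg ρ = σ}.encard =
        if t.c = 0 ∨ t.c = -1 / 2 then 1 else 2) ∧
    -- the Chevalley involution exchanges the two cases
    Set.BijOn (fun ρ : WittKind.pos.Alg →ₗ⁅ℂ⁆ Diff D => ρ.comp chevalleyNegPos)
      (RealizationsOf D WittKind.pos 0) (RealizationsOf D WittKind.neg 2) ∧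
    Set.BijOn (fun ρ : WittKind.neg.Alg →ₗ⁅ℂ⁆ Diff D => ρ.comp chevalleyPosNeg)
      (RealizationsOf D WittKind.neg 0) (RealizationsOf D WittKind.pos 2) ∧
    -- the empty cases
    RealizationsOf D WittKind.neg 0 = ∅ ∧ RealizationsOf D WittKind.pos 2 = ∅ ∧
    RealizationsOf D WittKind.full 0 = ∅ ∧ RealizationsOf D WittKind.full 2 = ∅ ∧
    RealizationsOf D WittKind.vir 0 = ∅ ∧ RealizationsOf D WittKind.vir 2 = ∅ := by
  have hD := exists_der_ne_zero hV
  have hdisj : ∀ (g : WittKind) (k l : ℕ), k ≠ l →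
      Disjoint (RealizationsOf D g k) (RealizationsOf D g l) := fun g k l hkl =>
    Set.disjoint_left.mpr fun ρ hk hl => hkl (hk.2.unique hD hl.2)
  refine ⟨⟨isBijectiveRel_zero hV, isBijectiveRel_one hV, isBijectiveRel_two hV⟩,
    fun g => ⟨⟨?_, hdisj g 0 1 (by norm_num), hdisj g 0 2 (by norm_num), hdisj g 1 2 (by norm_num)⟩,
      fun ρ hρ => restrictSl2_mem_iff.mpr hρ, restrictSl2_bijOn_one hV g,
      fun k hk => ⟨fun ρ hρ => restrictSl2_mem_of_iff.mpr hρ, ?_⟩,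
      fun ρ _ t ht h => eq_opOne_of_isTripleOne hV ht h⟩,
    ?_, ?_, surjOn_pos_zero hV, fun σ hσ t ht h => encard_fiber_pos_zero hV hσ ht h,
    ?_, surjOn_neg_two hV, fun σ hσ t ht h => encard_fiber_neg_two hV hσ ht h,
    bijOn_comp_chevalleyNegPos hV rfl, bijOn_comp_chevalleyPosNeg hV rfl,
    realizationsOf_zero_eq_empty hV (show (-2 : ℤ) ≤ 1 by norm_num),
    realizationsOf_two_eq_empty hV (show (-1 : ℤ) ≤ 2 by norm_num),
    realizationsOf_zero_eq_empty hV trivial, realizationsOf_two_eq_empty hV trivial,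
    realizationsOf_zero_eq_empty hV trivial, realizationsOf_two_eq_empty hV trivial⟩
  · refine Set.Subset.antisymm (fun ρ hρ => ?_)
      (Set.union_subset (Set.union_subset (fun _ h => h.1) fun _ h => h.1) fun _ h => h.1)
    obtain ⟨k, l, hkl, hk, -⟩ := slRealizations_subset hV (restrictSl2_mem_iff.mpr hρ)
    rw [restrictSl2_L] at hk
    obtain rfl | rfl | rfl : k = 0 ∨ k = 1 ∨ k = 2 := by omega
    exacts [Or.inl (Or.inl ⟨hρ, hk⟩), Or.inl (Or.inr ⟨hρ, hk⟩), Or.inr ⟨hρ, hk⟩]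
  · have hempty : RealizationsOf D g k = ∅ → ∀ σ,
        {ρ ∈ RealizationsOf D g k | restrictSl2 D g ρ = σ}.encard ≤ 2 := fun he σ => by
      simp [he]
    intro σ hσ
    -- Only `Witt_>` for `k = 0` and `Witt_<` for `k = 2` have realizations to count.
    rcases hk with rfl | rfl
    · cases g with
      | pos =>
        obtain ⟨t, ht, h⟩ := exists_isTripleZero hV hσ
        rw [encard_fiber_pos_zero hV hσ ht h]
        split_ifs <;> norm_num
      | neg => exact hempty (realizationsOf_zero_eq_empty hV (show (-2 : ℤ) ≤ 1 by norm_num)) σ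
      | full => exact hempty (realizationsOf_zero_eq_empty hV trivial) σ
      | vir => exact hempty (realizationsOf_zero_eq_empty hV trivial) σ
    · cases g with
      | neg =>
        obtain ⟨t, ht, h⟩ := exists_isTripleTwo hV hσ
        rw [encard_fiber_neg_two hV hσ ht h]
        split_ifs <;> norm_num
      | pos => exact hempty (realizationsOf_two_eq_empty hV (show (-1 : ℤ) ≤ 2 by norm_num)) σ
      | full => exact hempty (realizationsOf_two_eq_empty hV trivial) σ
      | vir => exact hempty (realizationsOf_two_eq_empty hV trivial) σ
  · intro ρ hρ
    obtain ⟨t, ht, h⟩ := exists_isTripleOne hV (restrictSl2_mem_of_iff.mpr hρ)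
    exact map_K_eq_zero hV ht h
  · intro ρ _ t ht h
    obtain ⟨l, hl, hq⟩ := exists_eq_wt_raisePoly hV ht.1 h
    refine ⟨l, hl, fun hi => ?_, fun hi => ?_, fun n hi _ => ?_⟩
    · rw [hq, raisePoly_zero, wt_zero_X]
    · rw [← h.1, restrictSl2_L]
    · rw [hq, wt_raisePoly_natCast]
  · intro ρ _ t ht h
    obtain ⟨l, hl, hq⟩ := exists_eq_lower hV ht.1 h
    refine ⟨l, hl, fun hi => ?_, fun hi => ?_, fun n hi _ => hq n hi⟩
    · rw [← h.2.1, restrictSl2_L]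
    · rw [← h.2.2, restrictSl2_L]
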